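/- Let $\varkappa:\mathbb R\to\mathbb R$ be the piecewise linear function with $\varkappa(t)=-1$ for $t\le-1$, $\varkappa(t)=t$ for $-1\le t\le1$ and $\varkappa(t)=1$ for $t\ge1$. Let $$\Omega_\varkappa(\delta)=\sup\big\{\|\varkappa(A)-\varkappa(B)\|\big\},\qquad \delta>0,$$ where the supremum is taken over all (not necessarily bounded) self-adjoint operators $A$ and $B$ acting on the same complex Hilbert space, with the same domain and with bounded difference satisfying $\|A-B\|\le\delta$; here $\varkappa(A)=\int_{\mathbb R}\varkappa\,dE_A$, where $E_A$ is the spectral measure of $A$, and similarly for $B$. Then there exist positive numbers $c_1$ and $c_2$ such that $$c_1\,\delta\log\big(1+\log(1+\delta^{-1})\big)\le\Omega_\varkappa(\delta)\le c_2\,\delta\log\big(1+\log(1+\delta^{-1})\big)$$ for every $\delta>0$. -/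

import Mathlib

open MeasureTheory
open scoped ENNReal BoundedContinuousFunction

universe u

noncomputable section

/-- A spectral measure on the real line: a countably additive (in the strong operator topology)
map from the Borel subsets of `ℝ` to the orthogonal projections of a Hilbert space, sending the
whole line to the identity. The values on non-Borel sets are never used. -/
structure SpectralMeasure (H : Type u) [NormedAddCommGroup H] [InnerProductSpace ℂ H]
    [CompleteSpace H] where
  proj : Set ℝ → H →L[ℂ] H
  isStarProjection : ∀ S, MeasurableSet S → IsStarProjection (proj S)
  proj_univ : proj Set.univ = 1
  hasSum_proj : ∀ S : ℕ → Set ℝ, (∀ n, MeasurableSet (S n)) →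
    Pairwise (Function.onFun Disjoint S) → ∀ x, HasSum (fun n => proj (S n) x) (proj (⋃ n, S n) x)

namespace SpectralMeasure

variable {H : Type u} [NormedAddCommGroup H] [InnerProductSpace ℂ H] [CompleteSpace H]

theorem proj_empty_apply (E : SpectralMeasure H) (x : H) : E.proj ∅ x = 0 := by
  have h := E.hasSum_proj (fun _ => ∅) (fun _ => MeasurableSet.empty)
    (fun _ _ _ => by simp [Function.onFun]) x
  exact tendsto_nhds_unique tendsto_const_nhds h.summable.tendsto_atTop_zero

theorem re_inner_proj (E : SpectralMeasure H) {S : Set ℝ} (hS : MeasurableSet S) (x : H) :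
    (inner ℂ x (E.proj S x)).re = ‖E.proj S x‖ ^ 2 := by
  have hp := E.isStarProjection S hS
  have h1 : E.proj S x = E.proj S (E.proj S x) := by
    conv_lhs => rw [← hp.isIdempotentElem.eq]
    rfl
  have h2 := hp.isSelfAdjoint.isSymmetric x (E.proj S x)
  simp only [ContinuousLinearMap.coe_coe] at h2
  rw [h1, ← h2, ← h1]
  exact inner_self_eq_norm_sq (𝕜 := ℂ) _

/-- The scalar measure `S ↦ ⟪x, E(S) x⟫ = ‖E(S) x‖ ^ 2` attached to the vector `x`. -/
def scalarMeasure (E : SpectralMeasure H) (x : H) : Measure ℝ :=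
  Measure.ofMeasurable (fun S _ => ENNReal.ofReal (‖E.proj S x‖ ^ 2))
    (by simp [E.proj_empty_apply])
    (by
      intro S hS hd
      have h := E.hasSum_proj S hS hd x
      have h' : HasSum (fun n => ‖E.proj (S n) x‖ ^ 2) (‖E.proj (⋃ n, S n) x‖ ^ 2) := by
        have h3 := Complex.hasSum_re (h.mapL (innerSL ℂ x))
        simp only [innerSL_apply_apply] at h3
        rw [E.re_inner_proj (MeasurableSet.iUnion hS)] at h3
        simpa only [E.re_inner_proj (hS _)] using h3
      change ENNReal.ofReal (‖E.proj (⋃ n, S n) x‖ ^ 2) =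
        ∑' n, ENNReal.ofReal (‖E.proj (S n) x‖ ^ 2)
      rw [← h'.tsum_eq]
      exact ENNReal.ofReal_tsum_of_nonneg (fun _ => by positivity) h'.summable)

theorem scalarMeasure_apply (E : SpectralMeasure H) (x : H) {S : Set ℝ} (hS : MeasurableSet S) :
    E.scalarMeasure x S = ENNReal.ofReal (‖E.proj S x‖ ^ 2) :=
  Measure.ofMeasurable_apply S hS

/-- `E` is the spectral measure of the (possibly unbounded) operator `A`, i.e. `A = ∫ t dE(t)`:
the domain of `A` is `{x | ∫ t ^ 2 d⟪x, E x⟫ < ∞}`, and `⟪x, A x⟫ = ∫ t d⟪x, E x⟫` on it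
(which determines `A` by polarization). -/
def IsSpectralMeasureOf (E : SpectralMeasure H) (A : H →ₗ.[ℂ] H) : Prop :=
  (∀ x : H, x ∈ A.domain ↔ Integrable (fun t : ℝ => t ^ 2) (E.scalarMeasure x)) ∧
    ∀ x : A.domain, inner ℂ (x : H) (A x) = ((∫ t, t ∂(E.scalarMeasure (x : H)) : ℝ) : ℂ)

end SpectralMeasure

/-- `T = f(A) = ∫ f(t) dE(t)`, where `E` is the spectral measure of `A` and `f` is a bounded
continuous function. -/
def IsFunctionOf {H : Type u} [NormedAddCommGroup H] [InnerProductSpace ℂ H] [CompleteSpace H]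
    (f : ℝ →ᵇ ℝ) (A : H →ₗ.[ℂ] H) (T : H →L[ℂ] H) : Prop :=
  ∃ E : SpectralMeasure H, E.IsSpectralMeasureOf A ∧
    ∀ x : H, inner ℂ x (T x) = ((∫ t, f t ∂(E.scalarMeasure x) : ℝ) : ℂ)

/-- `A - B` is a bounded operator with `‖A - B‖ ≤ δ`, for possibly unbounded `A` and `B`. -/
def NormSubLE {H : Type u} [NormedAddCommGroup H] [InnerProductSpace ℂ H]
    (A B : H →ₗ.[ℂ] H) (δ : ℝ) : Prop :=
  A.domain = B.domain ∧
    ∀ (x : H) (hA : x ∈ A.domain) (hB : x ∈ B.domain), ‖A ⟨x, hA⟩ - B ⟨x, hB⟩‖ ≤ δ * ‖x‖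

/-- The operator modulus of continuity of a bounded continuous function `f` on `ℝ`: the supremum of
`‖f(A) - f(B)‖` over all, not necessarily bounded, self-adjoint operators `A`, `B` on a complex
Hilbert space such that `‖A - B‖ ≤ δ`. -/
def operatorModulus (f : ℝ →ᵇ ℝ) (δ : ℝ) : ℝ≥0∞ :=
  sSup {r : ℝ≥0∞ | ∃ (H : Type u) (_ : NormedAddCommGroup H) (_ : InnerProductSpace ℂ H)
    (_ : CompleteSpace H) (A B : H →ₗ.[ℂ] H) (fA fB : H →L[ℂ] H),
    IsSelfAdjoint A ∧ IsSelfAdjoint B ∧ NormSubLE A B δ ∧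
    IsFunctionOf f A fA ∧ IsFunctionOf f B fB ∧ r = ‖fA - fB‖ₑ}

/-- The piecewise linear function equal to `-1` for `t ≤ -1`, to `t` on `[-1, 1]`, to `1` for
`t ≥ 1`. -/
def kappaFun (t : ℝ) : ℝ := if t ≤ -1 then -1 else if t ≤ 1 then t else 1

theorem kappaFun_eq (t : ℝ) : kappaFun t = max (-1) (min t 1) := by
  unfold kappaFun
  split_ifs with h1 h2
  · rw [min_eq_left (by linarith), max_eq_left h1]
  · rw [min_eq_left h2, max_eq_right (by linarith)]
  · rw [min_eq_right (by linarith), max_eq_right (by norm_num)]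

/-- `kappaFun` as a bounded continuous function. -/
def kappa : ℝ →ᵇ ℝ :=
  BoundedContinuousFunction.ofNormedAddCommGroup kappaFun
    (by
      rw [show kappaFun = fun t => max (-1) (min t 1) from funext kappaFun_eq]
      fun_prop)
    1
    (by
      intro t
      rw [kappaFun_eq, Real.norm_eq_abs, abs_le]
      exact ⟨le_max_left _ _, max_le (by norm_num) (min_le_right _ _)⟩)

end

/-! Upper bound. Round the spectra of `A` and `B` down to the lattice of step `1/N` with `N` about
`1/δ`; this costs only `O(δ)` in each difference. After restriction to finitely many lattice cells,
the difference of the rounded `κ(A)` and `κ(B)` is the Schur product of the divided difference of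
`κ` on the lattice with the rounded `A - B`. It remains to show that this divided difference is a
Schur multiplier of norm `O(log log N)` (`SchurLE.dividedDiff_clamp`). Cut along the two kinks, it
is trivial except on blocks with kernel `b / (a + b)`, where `a ≥ 0` and `1 ≤ b ≤ 2N` are the
distances to a kink. Where `a` is about `2 ^ k * b` with `k ≥ 0`, this kernel has multiplier norm
`O(2 ^ (-k))`, which is summable; where `b` dominates, it is `1 - a / (a + b)`. So up to a bounded
multiplier it is the triangular truncation in the dyadic levels of `a` and `b`. There are `O(log N)`
levels for `b`, and triangular truncation over `n` levels costs `O(log n)`.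

Lower bound. The same triangular truncation is realised by matrices. Let `A` be diagonal with
eigenvalues `1 ± 2⁻¹ ^ j`, `j < 2m`, and let `R` be Hermitian with off-diagonal blocks `s / ((j - k)
(2⁻¹ ^ j + 2⁻¹ ^ k))`. Its commutator with `A` is `s` times a Hilbert matrix up to signs, of norm at
most `π s` (`norm_commutator_kinkMatrix_le`). In the commutator with `κ(A)` the entries acquire the
weight `2⁻¹ ^ k / (2⁻¹ ^ j + 2⁻¹ ^ k)`, a smoothed triangular truncation, and the norm is at least
of order `s log m` (`le_norm_commutator_kappa_kinkMatrix`). The Cayley transform `U` of `R` converts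
commutators into differences `A - U A U⁻¹` (`exists_unitary_commutator`). The requirement `‖R‖ ≤ 1`
allows `m` of order `log (1/δ)`, hence `log m` of order `log log (1/δ)`.

For `δ > 1/16` both bounds are elementary: scalar operators from below, boundedness of `κ` from
above. -/

/-- A family of pairwise orthogonal orthogonal projections. -/
structure IsOrthogonalProjections {ι H : Type*} [NormedAddCommGroup H] [InnerProductSpace ℂ H]
    [CompleteSpace H] (P : ι → H →L[ℂ] H) : Prop where
  isStarProjection : ∀ i, IsStarProjection (P i)
  mul_eq_zero : ∀ i j, i ≠ j → P i * P j = 0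

/-! ### Orthogonal projections and block Schur multipliers. -/

section Schur

set_option linter.unusedSectionVars false

variable {ι κ H : Type*} [NormedAddCommGroup H] [InnerProductSpace ℂ H] [CompleteSpace H]

theorem IsStarProjection.inner_apply_apply {p : H →L[ℂ] H} (hp : IsStarProjection p) (x y : H) :
    inner ℂ (p x) y = inner ℂ x (p y) :=
  hp.isSelfAdjoint.isSymmetric x y

theorem IsStarProjection.apply_apply {p : H →L[ℂ] H} (hp : IsStarProjection p) (x : H) :
    p (p x) = p x :=
  DFunLike.congr_fun hp.isIdempotentElem.eq x

namespace IsOrthogonalProjections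

variable {P : ι → H →L[ℂ] H} {Q : κ → H →L[ℂ] H}

theorem apply_apply_of_ne (hP : IsOrthogonalProjections P) {i j : ι} (h : i ≠ j) (x : H) :
    P i (P j x) = 0 :=
  DFunLike.congr_fun (hP.mul_eq_zero i j h) x

theorem inner_eq_zero (hP : IsOrthogonalProjections P) {i j : ι} (h : i ≠ j) (x y : H) :
    inner ℂ (P i x) (P j y) = 0 := by
  rw [(hP.isStarProjection i).inner_apply_apply, hP.apply_apply_of_ne h, inner_zero_right]

/-- Pythagoras' theorem for vectors in the ranges of orthogonal projections. -/
theorem norm_sum_sq (hP : IsOrthogonalProjections P) (s : Finset ι) (x : ι → H) :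
    ‖∑ i ∈ s, P i (x i)‖ ^ 2 = ∑ i ∈ s, ‖P i (x i)‖ ^ 2 := by
  classical
  induction s using Finset.induction_on with
  | empty => simp
  | insert a s ha ih =>
    rw [Finset.sum_insert ha, Finset.sum_insert ha, ← ih, sq, sq, sq]
    refine norm_add_sq_eq_norm_sq_add_norm_sq_of_inner_eq_zero _ _ (𝕜 := ℂ) ?_
    rw [inner_sum]
    exact Finset.sum_eq_zero fun i hi =>
      hP.inner_eq_zero (ne_of_mem_of_not_mem hi ha).symm _ _

theorem sum_norm_sq_le (hP : IsOrthogonalProjections P) (s : Finset ι) (x : H) :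
    ∑ i ∈ s, ‖P i x‖ ^ 2 ≤ ‖x‖ ^ 2 := by
  have h1 : ∑ i ∈ s, ‖P i x‖ ^ 2 = (inner ℂ x (∑ i ∈ s, P i x)).re := by
    rw [inner_sum, Complex.re_sum]
    refine Finset.sum_congr rfl fun i _ => ?_
    rw [← (hP.isStarProjection i).apply_apply x, ← (hP.isStarProjection i).inner_apply_apply,
      (hP.isStarProjection i).apply_apply x]
    exact (inner_self_eq_norm_sq (𝕜 := ℂ) _).symm
  have h2 := hP.norm_sum_sq s fun _ => x
  have h3 : (inner ℂ x (∑ i ∈ s, P i x)).re ≤ ‖x‖ * ‖∑ i ∈ s, P i x‖ :=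
    (Complex.re_le_norm _).trans (norm_inner_le_norm _ _)
  rw [← h1, ← h2] at h3
  rw [← h2]
  have h4 : ‖∑ i ∈ s, P i x‖ ≤ ‖x‖ := by
    by_contra hc
    push Not at hc
    nlinarith [norm_nonneg x]
  gcongr

theorem norm_sum_smul_le (hP : IsOrthogonalProjections P) (s : Finset ι) {a : ι → ℝ} {c : ℝ}
    (hc : 0 ≤ c) (ha : ∀ i ∈ s, |a i| ≤ c) : ‖∑ i ∈ s, (a i : ℂ) • P i‖ ≤ c := by
  refine ContinuousLinearMap.opNorm_le_bound _ hc fun x => ?_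
  have h1 : (∑ i ∈ s, (a i : ℂ) • P i) x = ∑ i ∈ s, P i ((a i : ℂ) • x) := by
    simp
  have h2 := hP.norm_sum_sq s fun i => (a i : ℂ) • x
  have h3 : ∑ i ∈ s, ‖P i ((a i : ℂ) • x)‖ ^ 2 ≤ c ^ 2 * ‖x‖ ^ 2 := by
    refine le_trans ?_ (mul_le_mul_of_nonneg_left (hP.sum_norm_sq_le s x) (sq_nonneg c))
    rw [Finset.mul_sum]
    refine Finset.sum_le_sum fun i hi => ?_
    rw [map_smul, norm_smul, mul_pow, Complex.norm_real, Real.norm_eq_abs]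
    have := ha i hi
    gcongr
  rw [h1]
  refine le_of_sq_le_sq ?_ (by positivity)
  rw [h2, mul_pow]
  exact h3

theorem norm_sum_le_one (hP : IsOrthogonalProjections P) (s : Finset ι) : ‖∑ i ∈ s, P i‖ ≤ 1 := by
  simpa using hP.norm_sum_smul_le s (a := fun _ => 1) zero_le_one (by simp)

/-- Sums of orthogonal projections over the fibers of a map are again orthogonal projections. -/
theorem sum_fiber [Fintype ι] (hP : IsOrthogonalProjections P) {β : Type*} [DecidableEq β]
    (f : ι → β) : IsOrthogonalProjections fun b => ∑ i with f i = b, P i := by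
  classical
  have key : ∀ b c, (∑ i with f i = b, P i) * (∑ i with f i = c, P i) =
      if b = c then ∑ i with f i = b, P i else 0 := by
    intro b c
    rw [Finset.sum_mul_sum]
    split_ifs with h
    · subst h
      refine Finset.sum_congr rfl fun i hi => ?_
      rw [Finset.sum_eq_single_of_mem i hi fun j _ hj => hP.mul_eq_zero i j hj.symm]
      exact (hP.isStarProjection i).isIdempotentElem.eq
    · refine Finset.sum_eq_zero fun i hi => Finset.sum_eq_zero fun j hj => hP.mul_eq_zero i j ?_
      rintro rfl
      simp only [Finset.mem_filter_univ] at hi hj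
      exact h (hi.symm.trans hj)
  refine ⟨fun b => ⟨(key b b).trans (if_pos rfl), ?_⟩, fun b c h => by simpa [h] using key b c⟩
  exact isSelfAdjoint_sum _ fun i _ => (hP.isStarProjection i).isSelfAdjoint

end IsOrthogonalProjections

variable [Fintype ι] [Fintype κ]

/-- The Schur product of the kernel `φ` with the operator `T`, with respect to two families of
operators. -/
def schurProd (P : ι → H →L[ℂ] H) (Q : κ → H →L[ℂ] H) (φ : ι → κ → ℝ) (T : H →L[ℂ] H) : H →L[ℂ] H :=
  ∑ i, ∑ j, (φ i j : ℂ) • (P i * T * Q j)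

/-- The norm of the Schur multiplier with kernel `φ` is at most `C`. -/
def SchurLE (P : ι → H →L[ℂ] H) (Q : κ → H →L[ℂ] H) (φ : ι → κ → ℝ) (C : ℝ) : Prop :=
  ∀ T, ‖schurProd P Q φ T‖ ≤ C * ‖T‖

variable {P : ι → H →L[ℂ] H} {Q : κ → H →L[ℂ] H} {φ ψ : ι → κ → ℝ} {C D : ℝ}

theorem schurProd_add (T : H →L[ℂ] H) :
    schurProd P Q (fun i j => φ i j + ψ i j) T = schurProd P Q φ T + schurProd P Q ψ T := by
  simp [schurProd, add_smul, Finset.sum_add_distrib]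

theorem schurProd_const_mul (c : ℝ) (T : H →L[ℂ] H) :
    schurProd P Q (fun i j => c * φ i j) T = (c : ℂ) • schurProd P Q φ T := by
  simp [schurProd, Finset.smul_sum, mul_smul]

/-- Orthogonality isolates the block `P i * T * Q j`, so composing Schur products multiplies their
kernels. -/
theorem schurProd_schurProd (hP : IsOrthogonalProjections P) (hQ : IsOrthogonalProjections Q)
    (T : H →L[ℂ] H) :
    schurProd P Q φ (schurProd P Q ψ T) = schurProd P Q (fun i j => φ i j * ψ i j) T := by
  classical
  have h : ∀ i j, P i * schurProd P Q ψ T * Q j = (ψ i j : ℂ) • (P i * T * Q j) := by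
    intro i j
    simp only [schurProd, Finset.mul_sum, Finset.sum_mul]
    rw [Finset.sum_eq_single i, Finset.sum_eq_single j]
    · rw [mul_smul_comm, smul_mul_assoc]
      congr 1
      rw [← mul_assoc, ← mul_assoc, (hP.isStarProjection i).isIdempotentElem.eq, mul_assoc _ (Q j),
        (hQ.isStarProjection j).isIdempotentElem.eq]
    · intro k _ hk
      rw [mul_smul_comm, smul_mul_assoc, mul_assoc, mul_assoc, hQ.mul_eq_zero k j hk]
      simp
    · simp
    · intro k _ hk
      refine Finset.sum_eq_zero fun l _ => ?_
      rw [mul_smul_comm, smul_mul_assoc, ← mul_assoc, ← mul_assoc, hP.mul_eq_zero i k hk.symm]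
      simp
    · simp
  rw [schurProd]
  simp only [h]
  simp [schurProd, mul_smul]

theorem schurProd_row_col (a : ι → ℝ) (b : κ → ℝ) (T : H →L[ℂ] H) :
    schurProd P Q (fun i j => a i * b j) T =
      (∑ i, (a i : ℂ) • P i) * T * ∑ j, (b j : ℂ) • Q j := by
  rw [schurProd, Finset.sum_mul, Finset.sum_mul]
  refine Finset.sum_congr rfl fun i _ => ?_
  rw [Finset.mul_sum]
  refine Finset.sum_congr rfl fun j _ => ?_
  rw [smul_mul_assoc, smul_mul_assoc, mul_smul_comm, smul_smul]
  simp

namespace SchurLE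

theorem add (h₁ : SchurLE P Q φ C) (h₂ : SchurLE P Q ψ D) :
    SchurLE P Q (fun i j => φ i j + ψ i j) (C + D) := fun T => by
  rw [schurProd_add, add_mul]
  exact norm_add_le_of_le (h₁ T) (h₂ T)

theorem neg (h : SchurLE P Q φ C) : SchurLE P Q (fun i j => -φ i j) C := fun T => by
  simpa [schurProd] using h T

theorem sub (h₁ : SchurLE P Q φ C) (h₂ : SchurLE P Q ψ D) :
    SchurLE P Q (fun i j => φ i j - ψ i j) (C + D) := by
  simpa only [sub_eq_add_neg] using h₁.add h₂.neg

theorem mono (h : SchurLE P Q φ C) (hC : C ≤ D) : SchurLE P Q φ D := fun T =>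
  (h T).trans (by gcongr)

theorem congr (h : SchurLE P Q φ C) (he : ∀ i j, φ i j = ψ i j) : SchurLE P Q ψ C := by
  rwa [show ψ = φ from funext₂ fun i j => (he i j).symm]

theorem zero : SchurLE P Q (fun _ _ => 0) 0 := fun T => by simp [schurProd]

theorem sum {α : Type*} (s : Finset α) {φ : α → ι → κ → ℝ} {C : α → ℝ}
    (h : ∀ k ∈ s, SchurLE P Q (φ k) (C k)) :
    SchurLE P Q (fun i j => ∑ k ∈ s, φ k i j) (∑ k ∈ s, C k) := by
  classical
  induction s using Finset.induction_on with
  | empty => simpa using zero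
  | insert a s ha ih =>
    simp only [Finset.sum_insert ha]
    exact (h a (by simp)).add (ih fun k hk => h k (by simp [hk]))

variable (hP : IsOrthogonalProjections P) (hQ : IsOrthogonalProjections Q)
include hP hQ

theorem mul (h₁ : SchurLE P Q φ C) (h₂ : SchurLE P Q ψ D) (hC : 0 ≤ C) :
    SchurLE P Q (fun i j => φ i j * ψ i j) (C * D) := fun T => by
  rw [← schurProd_schurProd hP hQ, mul_assoc]
  exact (h₁ _).trans (by gcongr; exact h₂ T)

theorem row_mul_col {a : ι → ℝ} {b : κ → ℝ} (hC : 0 ≤ C) (hD : 0 ≤ D) (ha : ∀ i, |a i| ≤ C)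
    (hb : ∀ j, |b j| ≤ D) : SchurLE P Q (fun i j => a i * b j) (C * D) := fun T => by
  rw [schurProd_row_col]
  calc ‖(∑ i, (a i : ℂ) • P i) * T * ∑ j, (b j : ℂ) • Q j‖
      ≤ ‖∑ i, (a i : ℂ) • P i‖ * ‖T‖ * ‖∑ j, (b j : ℂ) • Q j‖ := norm_mul₃_le
    _ ≤ C * ‖T‖ * D := by
      gcongr
      · exact hP.norm_sum_smul_le _ hC fun i _ => ha i
      · exact hQ.norm_sum_smul_le _ hD fun i _ => hb i
    _ = _ := by ring

theorem row {a : ι → ℝ} (hC : 0 ≤ C) (ha : ∀ i, |a i| ≤ C) :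
    SchurLE P Q (fun i _ => a i) C := by
  simpa using row_mul_col hP hQ (b := fun _ => 1) hC zero_le_one ha (by simp)

theorem col {b : κ → ℝ} (hC : 0 ≤ C) (hb : ∀ i, |b i| ≤ C) :
    SchurLE P Q (fun _ j => b j) C := by
  simpa using row_mul_col hP hQ (a := fun _ => 1) zero_le_one hC (by simp) hb

/-- The kernel of a block of a matrix. -/
theorem rect (p : ι → Prop) (q : κ → Prop) [DecidablePred p] [DecidablePred q] :
    SchurLE P Q (fun i j => (if p i then 1 else 0) * (if q j then 1 else 0)) 1 := by
  simpa using row_mul_col hP hQ (a := fun i => if p i then 1 else 0)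
    (b := fun i => if q i then 1 else 0) zero_le_one zero_le_one
    (fun i => by split_ifs <;> simp) (fun i => by split_ifs <;> simp)

/-- The block diagonal part of a matrix. -/
theorem blockDiag {β : Type*} [DecidableEq β] (f : ι → β) (g : κ → β) :
    SchurLE P Q (fun i j => if f i = g j then 1 else 0) 1 := fun T => by
  classical
  set p : β → H →L[ℂ] H := fun b => ∑ i with f i = b, P i with hp
  set q : β → H →L[ℂ] H := fun b => ∑ i with g i = b, Q i with hq
  have hp' : IsOrthogonalProjections p := hP.sum_fiber f
  have hq' : IsOrthogonalProjections q := hQ.sum_fiber g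
  set s : Finset β := Finset.univ.image f
  -- The kernel pinches `T` to a sum of blocks `p b * T * q b` with orthogonal ranges and orthogonal
  -- initial spaces, so Pythagoras on both sides gives the bound `‖T‖`.
  have h : schurProd P Q (fun i j => if f i = g j then 1 else 0) T = ∑ b ∈ s, p b * T * q b := by
    have h2 : ∀ b, p b * T * q b =
        ∑ i with f i = b, ∑ j, ((if f i = g j then (1 : ℝ) else 0 : ℝ) : ℂ) • (P i * T * Q j) := by
      intro b
      simp only [hp, hq, Finset.sum_mul]
      refine Finset.sum_congr rfl fun i hi => ?_
      simp only [Finset.mem_filter_univ] at hi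
      rw [Finset.mul_sum, Finset.sum_filter]
      refine Finset.sum_congr rfl fun j _ => ?_
      rw [hi]
      by_cases hj : g j = b
      · simp [hj]
      · simp [hj, Ne.symm hj]
    simp only [h2]
    rw [Finset.sum_fiberwise_of_maps_to fun i _ => Finset.mem_image_of_mem f (Finset.mem_univ i)]
    rfl
  rw [h, one_mul]
  refine ContinuousLinearMap.opNorm_le_bound _ (norm_nonneg _) fun x => ?_
  have h1 : (∑ b ∈ s, p b * T * q b) x = ∑ b ∈ s, p b (T (q b x)) := by
    simp
  rw [h1]
  refine le_of_sq_le_sq ?_ (by positivity)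
  rw [hp'.norm_sum_sq s fun b => T (q b x), mul_pow]
  refine le_trans ?_ (mul_le_mul_of_nonneg_left (hq'.sum_norm_sq_le s x) (sq_nonneg ‖T‖))
  rw [Finset.mul_sum]
  refine Finset.sum_le_sum fun b _ => ?_
  rw [← mul_pow]
  gcongr
  have h3 : ‖p b‖ ≤ 1 := hP.norm_sum_le_one _
  calc ‖p b (T (q b x))‖ ≤ ‖p b‖ * ‖T (q b x)‖ := (p b).le_opNorm _
    _ ≤ 1 * (‖T‖ * ‖q b x‖) := by gcongr; exact T.le_opNorm _
    _ = _ := one_mul _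

/-- The kernel `1 / (a + b)`, for `a` and `b` bounded from below. -/
theorem inv_add {a : ι → ℝ} {b : κ → ℝ} {p q : ℝ} (ha : ∀ i, p ≤ a i) (hb : ∀ j, q ≤ b j)
    (hpq : 0 < p + q) : SchurLE P Q (fun i j => (a i + b j)⁻¹) (p + q)⁻¹ := fun T => by
  obtain ⟨p', hp'⟩ := (Set.finite_range a).bddAbove
  obtain ⟨q', hq'⟩ := (Set.finite_range b).bddAbove
  -- The maximum keeps `p ≤ p'` true even for an empty index type.
  replace hp' : ∀ i, a i ≤ max p p' := fun i => le_max_of_le_right (hp' ⟨i, rfl⟩)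
  replace hq' : ∀ i, b i ≤ max q q' := fun i => le_max_of_le_right (hq' ⟨i, rfl⟩)
  have hpp : p ≤ max p p' := le_max_left _ _
  have hqq : q ≤ max q q' := le_max_left _ _
  generalize max p p' = p' at *
  generalize max q q' = q' at *
  set X := schurProd P Q (fun i j => (a i + b j)⁻¹) T with hX
  have hab : ∀ i j, a i + b j ≠ 0 := fun i j => by linarith [ha i, hb j]
  have h1 : ‖schurProd P Q (fun i j => a i + b j) X‖ ≤ ‖T‖ := by
    have := row hP hQ (a := fun _ => 1) zero_le_one (by simp) T
    simpa [hX, schurProd_schurProd hP hQ, hab] using this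
  have h2 : ‖schurProd P Q (fun i j => ((p + p') / 2 - a i) + ((q + q') / 2 - b j)) X‖ ≤
      ((p' - p) / 2 + (q' - q) / 2) * ‖X‖ := by
    refine (add (row hP hQ ?_ ?_) (col hP hQ ?_ ?_)) X
    · linarith
    · intro i
      rw [abs_le]
      constructor <;> linarith [ha i, hp' i]
    · linarith
    · intro i
      rw [abs_le]
      constructor <;> linarith [hb i, hq' i]
  -- With `c` the midpoint of the range allowed for `a + b`, write `c = (a + b) + (c - a - b)`. The
  -- first kernel sends `X` back to the constant-one Schur product of `T`, the second is small on
  -- rows and columns. The upper bounds `p'`, `q'` cancel and leave `(p + q) * ‖X‖ ≤ ‖T‖`.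
  have h3 : (((p + p') / 2 + (q + q') / 2 : ℝ) : ℂ) • X = schurProd P Q (fun i j => a i + b j) X +
      schurProd P Q (fun i j => ((p + p') / 2 - a i) + ((q + q') / 2 - b j)) X := by
    rw [← schurProd_add, hX, schurProd_schurProd hP hQ, ← schurProd_const_mul]
    congr 1
    funext i j
    ring
  have h4 : ((p + p') / 2 + (q + q') / 2) * ‖X‖ ≤
      ‖T‖ + ((p' - p) / 2 + (q' - q) / 2) * ‖X‖ := by
    have h5 := norm_add_le_of_le h1 h2
    rw [← h3, norm_smul, Complex.norm_real, Real.norm_eq_abs, abs_of_nonneg (by linarith)] at h5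
    exact h5
  rw [← div_eq_inv_mul, le_div_iff₀ hpq]
  linarith

/-- Triangular truncation has norm logarithmic in the number of blocks. -/
theorem triangular (f : ι → ℕ) (g : κ → ℕ) (p : ℕ) (hg : ∀ j, g j < 2 ^ p) :
    SchurLE P Q (fun i j => if f i < g j then 1 else 0) p := by
  -- Compare only the leading binary digits and reveal one more digit at each step: `x < y` iff `x /
  -- 2 < y / 2`, or `x / 2 = y / 2` with `x` even and `y` odd. The second alternative is a block
  -- diagonal kernel times a rectangle, so each digit costs at most `1`.
  have key : ∀ l ≤ p, SchurLE P Q (fun i j => if f i / 2 ^ (p - l) < g j / 2 ^ (p - l)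
      then 1 else 0) l := by
    intro l
    induction l with
    | zero =>
      intro _
      refine zero.congr (fun i j => ?_) |>.mono (by simp)
      simp [Nat.div_eq_of_lt (hg j)]
    | succ l ih =>
      intro hl
      obtain ⟨m, hm⟩ : ∃ m, p - l = m + 1 := ⟨p - l - 1, by omega⟩
      have hm' : p - (l + 1) = m := by omega
      have h := (ih (by omega)).add ((blockDiag hP hQ (fun i => f i / 2 ^ (p - l))
        (fun j => g j / 2 ^ (p - l))).mul hP hQ (rect hP hQ (fun i => f i / 2 ^ m % 2 = 0)
          (fun j => g j / 2 ^ m % 2 = 1)) zero_le_one)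
      refine (h.mono (by push_cast; linarith)).congr fun i j => ?_
      rw [hm', hm, pow_succ, ← Nat.div_div_eq_div_mul, ← Nat.div_div_eq_div_mul]
      generalize f i / 2 ^ m = x
      generalize g j / 2 ^ m = y
      by_cases h1 : x / 2 < y / 2
      · have h2 : ¬ x / 2 = y / 2 := by omega
        have h3 : x < y := by omega
        simp [h1, h2, h3]
      · by_cases h2 : x / 2 = y / 2
        · have h3 : x < y ↔ (x % 2 = 0 ∧ y % 2 = 1) := by omega
          by_cases h4 : x % 2 = 0 <;> by_cases h5 : y % 2 = 1 <;> simp [h2, h3, h4, h5]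
        · have h3 : ¬ x < y := by omega
          simp [h1, h2, h3]
  simpa using key p le_rfl

end SchurLE

end Schur

/-! ### Dyadic analysis of the kernel `b / (a + b)`. -/

/-- The number of dyadic levels used for the triangular truncation. -/
def loglog (M : ℕ) : ℕ := Nat.log 2 (Nat.log 2 M) + 1

theorem log_lt_two_pow_loglog {M b : ℕ} (h : b ≤ M) : Nat.log 2 b < 2 ^ loglog M :=
  (Nat.log_mono_right h).trans_lt (Nat.lt_pow_succ_log_self one_lt_two _)

/-- The dyadic mantissa of a positive integer, a number in `[1, 2)`. -/
noncomputable def mantissa (a : ℕ) : ℝ := a / 2 ^ Nat.log 2 a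

theorem one_le_mantissa {a : ℕ} (ha : a ≠ 0) : 1 ≤ mantissa a := by
  rw [mantissa, one_le_div (by positivity)]
  exact_mod_cast Nat.pow_log_le_self 2 ha

theorem mantissa_le_two (a : ℕ) : mantissa a ≤ 2 := by
  rw [mantissa, div_le_iff₀ (by positivity), ← pow_succ']
  exact_mod_cast (Nat.lt_pow_succ_log_self one_lt_two a).le

theorem mantissa_mul (a : ℕ) : mantissa a * 2 ^ Nat.log 2 a = a :=
  div_mul_cancel₀ _ (by positivity)

theorem mantissa_nonneg (a : ℕ) : 0 ≤ mantissa a := by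
  unfold mantissa
  positivity

theorem sum_two_div_two_pow_add_one_le (s : ℕ) (n : ℕ) :
    ∑ k ∈ Finset.range n, 2 / ((2 : ℝ) ^ (k + s) + 1) ≤ 4 := by
  calc ∑ k ∈ Finset.range n, 2 / ((2 : ℝ) ^ (k + s) + 1)
      ≤ ∑ k ∈ Finset.range n, 2 * (1 / 2 : ℝ) ^ k := by
        refine Finset.sum_le_sum fun k _ => ?_
        rw [one_div, inv_pow, ← div_eq_mul_inv]
        gcongr
        have : (2 : ℝ) ^ k ≤ 2 ^ (k + s) := pow_le_pow_right₀ (by norm_num) (by omega)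
        linarith
    _ ≤ 4 := by
        rw [← Finset.mul_sum, geom_sum_eq (by norm_num)]
        have : (0 : ℝ) < (1 / 2) ^ n := by positivity
        rw [show ((1 / 2 : ℝ) - 1) = -(1 / 2) by norm_num, div_neg, div_div_eq_mul_div, div_one]
        linarith

namespace SchurLE

variable {ι κ H : Type*} [NormedAddCommGroup H] [InnerProductSpace ℂ H] [CompleteSpace H]
  [Fintype ι] [Fintype κ] {P : ι → H →L[ℂ] H} {Q : κ → H →L[ℂ] H} {φ : ι → κ → ℝ} {C : ℝ}

theorem swap {Q : ι → H →L[ℂ] H} {P : κ → H →L[ℂ] H} (hP : ∀ i, IsStarProjection (P i))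
    (hQ : ∀ i, IsStarProjection (Q i))
    (h : SchurLE Q P φ C) : SchurLE P Q (fun i j => φ j i) C := fun T => by
  have h1 : schurProd P Q (fun i j => φ j i) T = star (schurProd Q P φ (star T)) := by
    simp only [schurProd, star_sum, star_smul, star_mul, star_star]
    rw [Finset.sum_comm]
    simp [(hP _).isSelfAdjoint.star_eq, (hQ _).isSelfAdjoint.star_eq, mul_assoc]
  rw [h1, norm_star, ← norm_star T]
  exact h _

variable (hP : IsOrthogonalProjections P) (hQ : IsOrthogonalProjections Q)
include hP hQ

/-- The kernel `b / (a + b)` restricted to the dyadic blocks with `log a = log b + k`. -/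
theorem dyadic_band (a : ι → ℕ) (b : κ → ℕ) (ha : ∀ i, a i ≠ 0) (hb : ∀ j, b j ≠ 0) (k : ℕ) :
    SchurLE P Q (fun i j => if Nat.log 2 (a i) = Nat.log 2 (b j) + k
      then (b j : ℝ) / (a i + b j) else 0) (2 / (2 ^ k + 1)) := by
  -- On the band, dividing by `2 ^ Nat.log 2 (b j)` turns the kernel into `mantissa b / (2 ^ k *
  -- mantissa a + mantissa b)`, with mantissas in `[1, 2)`.
  have h1 : SchurLE P Q (fun i j => (2 ^ k * mantissa (a i) + mantissa (b j))⁻¹) (2 ^ k + 1)⁻¹ :=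
    inv_add hP hQ (fun i => le_mul_of_one_le_right (by positivity) (one_le_mantissa (ha i)))
      (fun j => one_le_mantissa (hb j)) (by positivity)
  have h2 : SchurLE P Q (fun _ j => mantissa (b j)) 2 := col hP hQ zero_le_two fun j => by
    rw [abs_of_nonneg (mantissa_nonneg _)]
    exact mantissa_le_two _
  have h3 := (blockDiag hP hQ (fun i => Nat.log 2 (a i)) (fun j => Nat.log 2 (b j) + k)).mul hP hQ
    (h2.mul hP hQ h1 zero_le_two) zero_le_one
  refine (h3.mono (by rw [one_mul, div_eq_mul_inv])).congr fun i j => ?_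
  split_ifs with h
  · rw [one_mul, ← mantissa_mul (a i), ← mantissa_mul (b j), mantissa_mul (a i),
      mantissa_mul (b j)]
    have hA := mantissa_mul (a i)
    have hB := mantissa_mul (b j)
    rw [h] at hA
    have h4 : (0 : ℝ) < 2 ^ Nat.log 2 (b j) := by positivity
    have h5 := one_le_mantissa (ha i)
    have h6 := one_le_mantissa (hb j)
    rw [← hA, ← hB, pow_add]
    have h7 : 0 < 2 ^ k * mantissa (a i) + mantissa (b j) := by positivity
    rw [← div_eq_mul_inv, div_eq_div_iff h7.ne' (by positivity)]
    ring
  · simp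

/-- The bands at level difference `k + s` have norms dominated by a geometric series; finiteness of
the index type bounds the number of bands needed. -/
theorem dyadic_upper (a : ι → ℕ) (b : κ → ℕ) (ha : ∀ i, a i ≠ 0) (hb : ∀ j, b j ≠ 0) (s : ℕ) :
    SchurLE P Q (fun i j => if Nat.log 2 (b j) + s ≤ Nat.log 2 (a i)
      then (b j : ℝ) / (a i + b j) else 0) 4 := by
  obtain ⟨n, hn⟩ := (Set.finite_range fun i => Nat.log 2 (a i)).bddAbove
  have h := sum (Finset.range (n + 1)) fun k _ => dyadic_band hP hQ a b ha hb (k + s)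
  refine (h.mono (sum_two_div_two_pow_add_one_le s _)).congr fun i j => ?_
  have hi : Nat.log 2 (a i) ≤ n := hn ⟨i, rfl⟩
  split_ifs with h
  · rw [Finset.sum_eq_single (Nat.log 2 (a i) - Nat.log 2 (b j) - s)]
    · rw [if_pos (by omega)]
    · intro k _ hk
      rw [if_neg (by omega)]
    · intro hk
      simp only [Finset.mem_range] at hk
      omega
  · exact Finset.sum_eq_zero fun k _ => if_neg (by omega)

/-- When the level of `a` is below that of `b`, the kernel is `1 - a / (a + b)`; otherwise it decays
by itself. Only the indicator of the first region costs more than a constant. The shifts `0` and `1`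
count equal levels exactly once. -/
theorem div_add_of_ne_zero (a : ι → ℕ) (b : κ → ℕ) (ha : ∀ i, a i ≠ 0) (hb : ∀ j, b j ≠ 0) {M : ℕ}
    (hM : ∀ j, b j ≤ M) :
    SchurLE P Q (fun i j => (b j : ℝ) / (a i + b j)) (loglog M + 8) := by
  have h1 := dyadic_upper hP hQ a b ha hb 0
  have h2 := (dyadic_upper hQ hP b a hb ha 1).swap hP.isStarProjection hQ.isStarProjection
  have h3 := triangular hP hQ (fun i => Nat.log 2 (a i)) (fun j => Nat.log 2 (b j)) (loglog M)
    fun j => log_lt_two_pow_loglog (hM j)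
  refine (((h3.add h1).sub h2).mono (by linarith)).congr fun i j => ?_
  have : (0 : ℝ) < b j + a i := by
    have := Nat.pos_of_ne_zero (ha i)
    positivity
  by_cases h : Nat.log 2 (a i) < Nat.log 2 (b j)
  · rw [if_pos h, if_neg (by omega), if_pos (by omega), add_zero, sub_eq_iff_eq_add,
      add_comm (a i : ℝ), ← add_div, div_self this.ne']
  · rw [if_neg h, if_pos (by omega), if_neg (by omega)]
    simp

/-- The kernel `b / (a + b)` for integers `a ≥ 0` and `1 ≤ b ≤ M`. -/
theorem div_add (a : ι → ℕ) (b : κ → ℕ) (hb : ∀ j, b j ≠ 0) {M : ℕ} (hM : ∀ j, b j ≤ M) :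
    SchurLE P Q (fun i j => (b j : ℝ) / (a i + b j)) (loglog M + 9) := by
  have h1 := div_add_of_ne_zero hP hQ (fun i => max 1 (a i)) b (fun i => by positivity) hb hM
  have h2 := (row hP hQ (a := fun i => if a i = 0 then 0 else 1) zero_le_one
    (fun i => by split_ifs <;> simp)).mul hP hQ h1 zero_le_one
  have h3 := h2.add (row hP hQ (a := fun i => if a i = 0 then 1 else 0) zero_le_one
    (fun i => by split_ifs <;> simp))
  refine (h3.mono (by linarith)).congr fun i j => ?_
  by_cases h : a i = 0
  · have : (b j : ℝ) ≠ 0 := by exact_mod_cast hb j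
    simp [h, div_self this]
  · have : 1 ≤ a i := Nat.one_le_iff_ne_zero.2 h
    simp [h, this]

end SchurLE

/-! ### The divided difference of the truncation on the integers. -/

/-- The divided difference of a function on the integers, with the value `0` on the diagonal. -/
noncomputable def dividedDiff (f : ℤ → ℝ) (m n : ℤ) : ℝ := (f m - f n) / ((m : ℝ) - n)

/-- The function on the integers equal to `-N` for `m ≤ -N`, to `m` for `-N ≤ m ≤ N` and to `N`
for `m ≥ N`. -/
def clamp (N : ℕ) (m : ℤ) : ℤ := max (-N) (min m N)

theorem clamp_neg (N : ℕ) (m : ℤ) : clamp N (-m) = -clamp N m := by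
  unfold clamp
  omega

namespace SchurLE

variable {ι κ H : Type*} [NormedAddCommGroup H] [InnerProductSpace ℂ H] [CompleteSpace H]
  [Fintype ι] [Fintype κ] {P : ι → H →L[ℂ] H} {Q : κ → H →L[ℂ] H} {φ : ι → κ → ℝ} {C : ℝ}
  (hP : IsOrthogonalProjections P) (hQ : IsOrthogonalProjections Q)
include hP hQ

/-- The block of the divided difference of `clamp` above its upper kink. -/
theorem dividedDiff_clamp_upper (x : ι → ℤ) (y : κ → ℤ) (N : ℕ) :
    SchurLE P Q (fun i j => if N ≤ x i ∧ -N < y j ∧ y j < N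
      then dividedDiff (fun m => clamp N m) (x i) (y j) else 0) (loglog (2 * N) + 9) := by
  by_cases hN : N = 0
  · subst hN
    refine (zero.mono (by positivity)).congr fun i j => ?_
    rw [if_neg (by push_cast; omega)]
  -- The variables are the distances to the kink: `a = x - N` and `b = N - y`, with `1 ≤ b < 2N` on
  -- the block. The truncations by `max` and `min` matter only off the block, where the rectangle
  -- kills the kernel.
  have h1 := div_add hP hQ (fun i => (x i - N).toNat) (fun j => max 1 (min (2 * N) (N - y j).toNat))
    (fun j => by positivity) (M := 2 * N) (fun j => by omega)
  have h2 := (rect hP hQ (fun i => N ≤ x i) (fun j => -N < y j ∧ y j < N)).mul hP hQ h1 zero_le_one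
  refine (h2.mono (by rw [one_mul])).congr fun i j => ?_
  by_cases hi : N ≤ x i
  · by_cases hj : -N < y j ∧ y j < N
    · rw [if_pos hi, if_pos hj, if_pos ⟨hi, hj⟩, one_mul, one_mul, dividedDiff]
      have e1 : (((x i - N).toNat : ℕ) : ℝ) = x i - N := by
        rw [← Int.cast_natCast, Int.toNat_of_nonneg (by omega)]
        push_cast; rfl
      have e2 : ((max 1 (min (2 * N) (N - y j).toNat) : ℕ) : ℝ) = N - y j := by
        rw [show max 1 (min (2 * N) (N - y j).toNat) = (N - y j).toNat by omega,
          ← Int.cast_natCast, Int.toNat_of_nonneg (by omega)]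
        push_cast; rfl
      rw [e1, e2, show clamp N (x i) = N by unfold clamp; omega,
        show clamp N (y j) = y j by unfold clamp; omega]
      push_cast
      congr 1
      ring
    · rw [if_neg hj, mul_zero, zero_mul, if_neg fun h => hj h.2]
  · rw [if_neg hi, zero_mul, zero_mul, if_neg fun h => hi h.1]

/-- The block of the divided difference of `clamp` below its lower kink. -/
theorem dividedDiff_clamp_lower (x : ι → ℤ) (y : κ → ℤ) (N : ℕ) :
    SchurLE P Q (fun i j => if x i ≤ -N ∧ -N < y j ∧ y j < N
      then dividedDiff (fun m => clamp N m) (x i) (y j) else 0) (loglog (2 * N) + 9) := by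
  refine (dividedDiff_clamp_upper hP hQ (fun i => -x i) (fun j => -y j) N).congr fun i j => ?_
  have h : dividedDiff (fun m => clamp N m) (-x i) (-y j) =
      dividedDiff (fun m => clamp N m) (x i) (y j) := by
    simp only [dividedDiff, clamp_neg]
    push_cast
    rw [← neg_div_neg_eq]
    congr 1 <;> ring
  rw [h]
  exact if_congr (by omega) rfl rfl

/-- On this block the kernel is `2N / (x + (-y))` with both terms at least `N`, and `inv_add` gives
`2N / (2N)`. -/
theorem dividedDiff_clamp_far (x : ι → ℤ) (y : κ → ℤ) {N : ℕ} (hN : N ≠ 0) :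
    SchurLE P Q (fun i j => if N ≤ x i ∧ y j ≤ -N
      then dividedDiff (fun m => clamp N m) (x i) (y j) else 0) 1 := by
  have hN' : (0 : ℝ) < N := by positivity
  have h1 := inv_add hP hQ (a := fun i => ((max (x i) N : ℤ) : ℝ))
    (b := fun j => ((max (-y j) N : ℤ) : ℝ)) (p := N) (q := N)
    (fun i => by exact_mod_cast le_max_right _ _) (fun i => by exact_mod_cast le_max_right _ _)
    (by positivity)
  have h2 := (row hP hQ (a := fun _ => 2 * (N : ℝ)) (C := 2 * N) (by positivity)
    (fun i => by rw [abs_of_nonneg (by positivity)])).mul hP hQ h1 (by positivity)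
  have h3 := (rect hP hQ (fun i => N ≤ x i) (fun j => y j ≤ -N)).mul hP hQ h2 zero_le_one
  refine (h3.mono (by rw [← two_mul, mul_inv_cancel₀ (by positivity), one_mul])).congr fun i j => ?_
  by_cases hi : N ≤ x i
  · by_cases hj : y j ≤ -N
    · rw [if_pos hi, if_pos hj, if_pos ⟨hi, hj⟩, one_mul, one_mul, dividedDiff, max_eq_left hi,
        max_eq_left (by omega), show clamp N (x i) = N by unfold clamp; omega,
        show clamp N (y j) = -N by unfold clamp; omega, ← div_eq_mul_inv]
      push_cast
      congr 1
      ring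
    · rw [if_neg hj, mul_zero, zero_mul, if_neg fun h => hj h.2]
  · rw [if_neg hi, zero_mul, zero_mul, if_neg fun h => hi h.1]

/-- The divided difference of `clamp N` is a Schur multiplier of norm `O(log (log N))`. -/
theorem dividedDiff_clamp (x : ι → ℤ) (y : κ → ℤ) {N : ℕ} (hN : N ≠ 0) :
    SchurLE P Q (fun i j => dividedDiff (fun m => clamp N m) (x i) (y j))
      (4 * loglog (2 * N) + 40) := by
  have hc : ∀ m n, dividedDiff (fun m => clamp N m) m n = dividedDiff (fun m => clamp N m) n m := by
    intro m n
    rw [dividedDiff, dividedDiff, ← neg_div_neg_eq, neg_sub, neg_sub]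
  have h1 := dividedDiff_clamp_upper hP hQ x y N
  have h2 := (dividedDiff_clamp_upper hQ hP y x N).swap hP.isStarProjection hQ.isStarProjection
  have h3 := dividedDiff_clamp_lower hP hQ x y N
  have h4 := (dividedDiff_clamp_lower hQ hP y x N).swap hP.isStarProjection hQ.isStarProjection
  have h5 := dividedDiff_clamp_far hP hQ x y hN
  have h6 := (dividedDiff_clamp_far hQ hP y x hN).swap hP.isStarProjection hQ.isStarProjection
  -- Between the kinks the divided difference is `1` off the diagonal and `0` on it. With four kink
  -- blocks, two far blocks and this one, the constant is `4 * 9 + 2 + 2 = 40`; the two blocks with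
  -- both variables beyond the same kink vanish.
  have h7 := rect hP hQ (fun i => -N < x i ∧ x i < N) (fun j => -N < y j ∧ y j < N)
  have h8 := h7.mul hP hQ (blockDiag hP hQ x y) zero_le_one
  have h := (((h1.add h2).add (h3.add h4)).add (h5.add h6)).add (h7.sub h8)
  refine (h.mono (by linarith)).congr fun i j => ?_
  simp only [hc (y j) (x i)]
  have hclamp : ∀ m : ℤ, (m ≤ -N ∧ clamp N m = -N) ∨ ((-N < m ∧ m < N) ∧ clamp N m = m) ∨
      (N ≤ m ∧ clamp N m = N) := by
    intro m
    unfold clamp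
    omega
  have hzero : ∀ m n : ℤ, clamp N m = clamp N n → dividedDiff (fun m => clamp N m) m n = 0 := by
    intro m n h
    rw [dividedDiff, h, sub_self, zero_div]
  rcases hclamp (x i) with ⟨a1, a2⟩ | ⟨a1, a2⟩ | ⟨a1, a2⟩ <;>
  rcases hclamp (y j) with ⟨b1, b2⟩ | ⟨b1, b2⟩ | ⟨b1, b2⟩
  · rw [hzero _ _ (by omega)]
    simp [show ¬ -(N : ℤ) < x i by omega]
  · simp [a1, b1, show ¬ (N : ℤ) ≤ x i by omega, show ¬ -(N : ℤ) < x i by omega,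
      show ¬ (N : ℤ) ≤ y j by omega, show ¬ y j ≤ -(N : ℤ) by omega]
  · simp [a1, b1, show ¬ (N : ℤ) ≤ x i by omega, show ¬ -(N : ℤ) < x i by omega,
      show ¬ y j < (N : ℤ) by omega, show ¬ y j ≤ -(N : ℤ) by omega]
  · simp [a1, b1, show ¬ (N : ℤ) ≤ x i by omega, show ¬ x i ≤ -(N : ℤ) by omega,
      show ¬ (N : ℤ) ≤ y j by omega, show ¬ -(N : ℤ) < y j by omega]
  · have e : dividedDiff (fun m => clamp N m) (x i) (y j) = 1 - if x i = y j then 1 else 0 := by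
      rw [dividedDiff, a2, b2]
      split_ifs with he
      · simp [he]
      · rw [div_self, sub_zero]
        rw [sub_ne_zero]
        exact_mod_cast he
    rw [e]
    simp [a1, b1, show ¬ (N : ℤ) ≤ x i by omega, show ¬ x i ≤ -(N : ℤ) by omega,
      show ¬ (N : ℤ) ≤ y j by omega, show ¬ y j ≤ -(N : ℤ) by omega]
  · simp [a1, b1, show ¬ (N : ℤ) ≤ x i by omega, show ¬ x i ≤ -(N : ℤ) by omega,
      show ¬ y j < (N : ℤ) by omega, show ¬ y j ≤ -(N : ℤ) by omega]
  · simp [a1, b1, show ¬ x i < (N : ℤ) by omega, show ¬ x i ≤ -(N : ℤ) by omega,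
      show ¬ (N : ℤ) ≤ y j by omega, show ¬ -(N : ℤ) < y j by omega]
  · simp [a1, b1, show ¬ x i < (N : ℤ) by omega, show ¬ x i ≤ -(N : ℤ) by omega,
      show ¬ (N : ℤ) ≤ y j by omega, show ¬ y j ≤ -(N : ℤ) by omega]
  · rw [hzero _ _ (by omega)]
    simp [show ¬ x i < (N : ℤ) by omega]

end SchurLE

/-! ### Polarization estimates for quadratic forms. -/

section QuadraticForm

variable {H : Type*} [NormedAddCommGroup H] [InnerProductSpace ℂ H]

/-- A sesquilinear form is bounded by twice the bound of its quadratic form. -/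
theorem norm_inner_le_of_norm_inner_self_le {D : Submodule ℂ H} (N : D →ₗ[ℂ] H) {h : ℝ}
    (hN : ∀ x : D, ‖inner ℂ (x : H) (N x)‖ ≤ h * ‖x‖ ^ 2) (y w : D) :
    ‖inner ℂ (y : H) (N w)‖ ≤ 2 * h * ‖y‖ * ‖w‖ := by
  have key : ∀ y w : D, ‖inner ℂ (y : H) (N w)‖ ≤ h * (‖y‖ ^ 2 + ‖w‖ ^ 2) := by
    intro y w
    have e : 4 * inner ℂ (y : H) (N w) = inner ℂ ((y + w : D) : H) (N (y + w)) -
        inner ℂ ((y - w : D) : H) (N (y - w)) -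
        Complex.I * inner ℂ ((y + Complex.I • w : D) : H) (N (y + Complex.I • w)) +
        Complex.I * inner ℂ ((y - Complex.I • w : D) : H) (N (y - Complex.I • w)) := by
      simp only [map_add, map_sub, map_smul, Submodule.coe_add, Submodule.coe_sub,
        Submodule.coe_smul, inner_add_left, inner_add_right, inner_sub_left, inner_sub_right,
        inner_smul_left, inner_smul_right, Complex.conj_I]
      ring_nf
      simp only [Complex.I_sq]
      ring
    have e2 : 4 * ‖inner ℂ (y : H) (N w)‖ ≤ h * ‖y + w‖ ^ 2 + h * ‖y - w‖ ^ 2 +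
        h * ‖y + Complex.I • w‖ ^ 2 + h * ‖y - Complex.I • w‖ ^ 2 := by
      have : ‖4 * inner ℂ (y : H) (N w)‖ = 4 * ‖inner ℂ (y : H) (N w)‖ := by simp
      rw [← this, e]
      refine norm_add_le_of_le (norm_sub_le_of_le (norm_sub_le_of_le (hN _) (hN _)) ?_) ?_
      · rw [norm_mul, Complex.norm_I, one_mul]
        exact hN _
      · rw [norm_mul, Complex.norm_I, one_mul]
        exact hN _
    have p1 := parallelogram_law_with_norm ℂ y w
    have p2 := parallelogram_law_with_norm ℂ y (Complex.I • w)
    rw [norm_smul, Complex.norm_I, one_mul] at p2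
    have e3 : h * ‖y + w‖ ^ 2 + h * ‖y - w‖ ^ 2 + h * ‖y + Complex.I • w‖ ^ 2 +
        h * ‖y - Complex.I • w‖ ^ 2 = 4 * (h * (‖y‖ ^ 2 + ‖w‖ ^ 2)) := by
      linear_combination h * p1 + h * p2
    linarith
  rcases eq_or_ne y 0 with rfl | hy
  · simp
  rcases eq_or_ne w 0 with rfl | hw
  · simp
  have hy' : 0 < ‖y‖ := norm_pos_iff.2 hy
  have hw' : 0 < ‖w‖ := norm_pos_iff.2 hw
  -- Rescaling both vectors to equal norm turns the sum of squares into a product.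
  have h1 := key ((‖w‖ : ℂ) • y) ((‖y‖ : ℂ) • w)
  rw [map_smul, Submodule.coe_smul, inner_smul_left, inner_smul_right, norm_smul, norm_smul,
    norm_mul, norm_mul] at h1
  simp only [Complex.conj_ofReal, Complex.norm_real, norm_norm] at h1
  have h2 : 0 < ‖w‖ * ‖y‖ := by positivity
  refine le_of_mul_le_mul_left ?_ h2
  nlinarith [h1]

/-- Polarization: reality of the form at `y + w` and at `y + I • w` yields the imaginary and real
parts of the identity. -/
theorem inner_map_eq_of_inner_self_real {D : Submodule ℂ H} (N : D →ₗ[ℂ] H)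
    (hN : ∀ x : D, (inner ℂ (x : H) (N x)).im = 0) (y w : D) :
    inner ℂ (N y) (w : H) = inner ℂ (y : H) (N w) := by
  have h1 := hN (y + w)
  have h2 := hN (y + Complex.I • w)
  have h3 := hN y
  have h4 := hN w
  simp only [map_add, map_smul, Submodule.coe_add, Submodule.coe_smul, inner_add_left,
    inner_add_right, inner_smul_left, inner_smul_right, Complex.conj_I, Complex.add_im,
    Complex.add_re, Complex.mul_re, Complex.mul_im, Complex.neg_re, Complex.neg_im, Complex.I_re, Complex.I_im] at h1 h2
  rw [← inner_conj_symm]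
  apply Complex.ext
  · rw [Complex.conj_re]
    linarith
  · rw [Complex.conj_im]
    linarith

theorem ContinuousLinearMap.norm_le_of_norm_inner_le {T : H →L[ℂ] H} {c : ℝ} (hc : 0 ≤ c)
    (h : ∀ x y, ‖inner ℂ x (T y)‖ ≤ c * ‖x‖ * ‖y‖) : ‖T‖ ≤ c := by
  refine T.opNorm_le_bound hc fun y => ?_
  have h1 := h (T y) y
  rw [inner_self_eq_norm_sq_to_K] at h1
  rcases eq_or_ne (T y) 0 with h0 | h0
  · rw [h0, norm_zero]
    positivity
  have h2 : 0 < ‖T y‖ := norm_pos_iff.2 h0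
  simp only [Complex.coe_algebraMap, norm_pow, Complex.norm_real, norm_norm] at h1
  refine le_of_mul_le_mul_left ?_ h2
  linarith

end QuadraticForm

/-! ### Multiplicativity of spectral measures and approximation by step functions. -/

namespace SpectralMeasure

variable {H : Type u} [NormedAddCommGroup H] [InnerProductSpace ℂ H] [CompleteSpace H]
  (E : SpectralMeasure H) {S T W : Set ℝ}

theorem proj_union (hS : MeasurableSet S) (hT : MeasurableSet T) (h : Disjoint S T) (x : H) :
    E.proj (S ∪ T) x = E.proj S x + E.proj T x := by
  set f : ℕ → Set ℝ := fun n => if n = 0 then S else if n = 1 then T else ∅ with hf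
  have h1 := E.hasSum_proj f (fun n => by simp only [hf]; split_ifs <;> simp [hS, hT])
    (fun m n hmn => by
      simp only [Function.onFun, hf]
      split_ifs <;> simp_all [disjoint_comm]) x
  have h2 : (⋃ n, f n) = S ∪ T := by
    ext t
    simp only [Set.mem_iUnion, Set.mem_union]
    constructor
    · rintro ⟨n, hn⟩
      simp only [hf] at hn
      split_ifs at hn <;> simp_all
    · rintro (ht | ht)
      · exact ⟨0, by simpa [hf] using ht⟩
      · exact ⟨1, by simpa [hf] using ht⟩
  rw [h2] at h1
  have h3 : HasSum (fun n => E.proj (f n) x) (∑ n ∈ Finset.range 2, E.proj (f n) x) :=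
    hasSum_sum_of_ne_finset_zero fun n hn => by
      simp only [Finset.mem_range] at hn
      simp only [hf]
      rw [if_neg (by omega), if_neg (by omega), E.proj_empty_apply]
  rw [h1.unique h3]
  simp [Finset.sum_range_succ, hf]

theorem norm_proj_le (hS : MeasurableSet S) (x : H) : ‖E.proj S x‖ ≤ ‖x‖ := by
  have h1 := E.re_inner_proj hS x
  have h2 : (inner ℂ x (E.proj S x)).re ≤ ‖x‖ * ‖E.proj S x‖ :=
    (Complex.re_le_norm _).trans (norm_inner_le_norm _ _)
  by_contra! hc
  nlinarith [norm_nonneg x]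

theorem norm_proj_union_sq (hS : MeasurableSet S) (hT : MeasurableSet T) (h : Disjoint S T)
    (x : H) : ‖E.proj (S ∪ T) x‖ ^ 2 = ‖E.proj S x‖ ^ 2 + ‖E.proj T x‖ ^ 2 := by
  rw [← E.re_inner_proj (hS.union hT), E.proj_union hS hT h, inner_add_right, Complex.add_re,
    E.re_inner_proj hS, E.re_inner_proj hT]

/-- Additivity of the squared norms at `E.proj T x`, together with the contractivity of `E.proj (S ∪
T)`, leaves no room for the component in `S`. Multiplicativity of the spectral measure, which is not
an axiom here, follows from this. -/
theorem proj_proj_of_disjoint (hS : MeasurableSet S) (hT : MeasurableSet T) (h : Disjoint S T)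
    (x : H) : E.proj S (E.proj T x) = 0 := by
  have h1 := E.norm_proj_union_sq hS hT h (E.proj T x)
  have h2 := E.norm_proj_le (hS.union hT) (E.proj T x)
  rw [(E.isStarProjection T hT).apply_apply] at h1
  have h3 : ‖E.proj S (E.proj T x)‖ ^ 2 ≤ 0 := by
    have := pow_le_pow_left₀ (norm_nonneg _) h2 2
    linarith
  simpa using h3

theorem proj_proj (hS : MeasurableSet S) (hT : MeasurableSet T) (x : H) :
    E.proj S (E.proj T x) = E.proj (S ∩ T) x := by
  have h1 := E.proj_union (hT.inter hS) (hT.diff hS) Set.disjoint_sdiff_inter.symm x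
  rw [Set.inter_union_sdiff] at h1
  have h2 := E.proj_union (hS.inter hT) (hS.diff hT) Set.disjoint_sdiff_inter.symm
    (E.proj (S ∩ T) x)
  rw [Set.inter_union_sdiff] at h2
  rw [h1, map_add, E.proj_proj_of_disjoint hS (hT.diff hS) Set.disjoint_sdiff_right, add_zero,
    Set.inter_comm T S, h2, (E.isStarProjection _ (hS.inter hT)).apply_apply,
    E.proj_proj_of_disjoint (hS.diff hT) (hS.inter hT)
      (Set.disjoint_sdiff_left.mono_right Set.inter_subset_right), add_zero]

theorem isOrthogonalProjections {ι : Type*} {S : ι → Set ℝ} (hS : ∀ i, MeasurableSet (S i))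
    (hd : Pairwise (Function.onFun Disjoint S)) :
    IsOrthogonalProjections fun i => E.proj (S i) :=
  ⟨fun i => E.isStarProjection _ (hS i), fun i j hij =>
    ContinuousLinearMap.ext fun x => E.proj_proj_of_disjoint (hS i) (hS j) (hd hij) x⟩

theorem proj_biUnion {ι : Type*} (s : Finset ι) {S : ι → Set ℝ} (hS : ∀ i, MeasurableSet (S i))
    (hd : Pairwise (Function.onFun Disjoint S)) (x : H) :
    E.proj (⋃ i ∈ s, S i) x = ∑ i ∈ s, E.proj (S i) x := by
  classical
  induction s using Finset.induction_on with
  | empty => simp [E.proj_empty_apply]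
  | insert a s ha ih =>
    rw [Finset.set_biUnion_insert, Finset.sum_insert ha, ← ih]
    refine E.proj_union (hS a) (s.measurableSet_biUnion fun i _ => hS i) ?_ x
    rw [Set.disjoint_iUnion₂_right]
    exact fun i hi => hd (ne_of_mem_of_not_mem hi ha).symm

instance (x : H) : IsFiniteMeasure (E.scalarMeasure x) :=
  ⟨by rw [E.scalarMeasure_apply x MeasurableSet.univ]; exact ENNReal.ofReal_lt_top⟩

theorem scalarMeasure_real_apply (x : H) (hS : MeasurableSet S) :
    (E.scalarMeasure x).real S = ‖E.proj S x‖ ^ 2 := by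
  rw [Measure.real, E.scalarMeasure_apply x hS, ENNReal.toReal_ofReal (by positivity)]

theorem scalarMeasure_real_univ (x : H) : (E.scalarMeasure x).real Set.univ = ‖x‖ ^ 2 := by
  rw [E.scalarMeasure_real_apply x MeasurableSet.univ, E.proj_univ]
  rfl

theorem ae_mem_of_proj_eq (hW : MeasurableSet W) {x : H} (hx : E.proj W x = x) :
    ∀ᵐ t ∂E.scalarMeasure x, t ∈ W := by
  rw [ae_iff]
  change E.scalarMeasure x Wᶜ = 0
  rw [E.scalarMeasure_apply x hW.compl, ← hx,
    E.proj_proj_of_disjoint hW.compl hW disjoint_compl_left]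
  simp

theorem scalarMeasure_add (hW : MeasurableSet W) {v w : H} (hv : E.proj W v = 0)
    (hw : E.proj W w = w) :
    E.scalarMeasure (v + w) = E.scalarMeasure v + E.scalarMeasure w := by
  ext S hS
  rw [Measure.add_apply, E.scalarMeasure_apply _ hS, E.scalarMeasure_apply _ hS,
    E.scalarMeasure_apply _ hS, ← ENNReal.ofReal_add (by positivity) (by positivity), map_add]
  congr 1
  rw [sq, sq, sq]
  refine norm_add_sq_eq_norm_sq_add_norm_sq_of_inner_eq_zero _ _ (𝕜 := ℂ) ?_
  rw [← hw, E.proj_proj hS hW, Set.inter_comm, ← E.proj_proj hW hS,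
    ← (E.isStarProjection W hW).inner_apply_apply, E.proj_proj hW hS, Set.inter_comm,
    ← E.proj_proj hS hW, hv, map_zero, inner_zero_left]

/-- `L` is an operator whose quadratic form is `∫ f dE`. -/
structure IsFormOf (E : SpectralMeasure H) (f : ℝ → ℝ) (L : H →ₗ.[ℂ] H) : Prop where
  integrable : ∀ x : L.domain, Integrable f (E.scalarMeasure (x : H))
  inner_self : ∀ x : L.domain,
    inner ℂ (x : H) (L x) = ((∫ t, f t ∂(E.scalarMeasure (x : H)) : ℝ) : ℂ)

theorem IsFormOf.inner_apply {E : SpectralMeasure H} {f : ℝ → ℝ} {L : H →ₗ.[ℂ] H}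
    (hL : E.IsFormOf f L) (x y : L.domain) :
    inner ℂ (L x) (y : H) = inner ℂ (x : H) (L y) :=
  inner_map_eq_of_inner_self_real L.toFun (fun x => by
    have := hL.inner_self x
    rw [LinearPMap.toFun_eq_coe, this, Complex.ofReal_im]) x y

/-- A substitute for the commutation of `L` with the spectral projections. Scalar measures add over
`v` and `w`, so the cross terms of the quadratic form cancel; using both `w` and `I • w` makes each
cross term vanish. -/
theorem IsFormOf.inner_eq_zero {E : SpectralMeasure H} {f : ℝ → ℝ} {L : H →ₗ.[ℂ] H}
    (hL : E.IsFormOf f L) (hW : MeasurableSet W) {v w : L.domain} (hv : E.proj W v = 0)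
    (hw : E.proj W w = w) : inner ℂ (v : H) (L w) = 0 := by
  have key : ∀ w : L.domain, E.proj W w = w →
      inner ℂ (v : H) (L w) + inner ℂ (w : H) (L v) = 0 := by
    intro w hw
    have h1 := hL.inner_self (v + w)
    rw [Submodule.coe_add, E.scalarMeasure_add hW hv hw,
      integral_add_measure (hL.integrable v) (hL.integrable w), Complex.ofReal_add,
      ← hL.inner_self, ← hL.inner_self, LinearPMap.map_add, inner_add_left, inner_add_right,
      inner_add_right] at h1
    linear_combination h1
  have h1 := key w hw
  have h2 := key (Complex.I • w) (by simp [hw])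
  rw [LinearPMap.map_smul, Submodule.coe_smul, inner_smul_left, inner_smul_right,
    Complex.conj_I] at h2
  have h3 : Complex.I * (2 * inner ℂ (v : H) (L w)) = 0 := by
    linear_combination h2 + Complex.I * h1
  simpa using h3

/-- Approximation of an operator by a step function of it, on the range of a spectral projection. -/
theorem IsFormOf.norm_inner_sub_le {E : SpectralMeasure H} {f : ℝ → ℝ} {L : H →ₗ.[ℂ] H}
    (hL : E.IsFormOf f L) {ι : Type*} {s : Finset ι} {S : ι → Set ℝ}
    (hS : ∀ i, MeasurableSet (S i)) (hd : Pairwise (Function.onFun Disjoint S)) {c : ι → ℝ} {h : ℝ}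
    (hc : ∀ i ∈ s, ∀ t ∈ S i, |f t - c i| ≤ h)
    (hdom : ∀ x, E.proj (⋃ i ∈ s, S i) x ∈ L.domain) (z w : L.domain)
    (hw : E.proj (⋃ i ∈ s, S i) w = w) (h0 : 0 ≤ h) :
    ‖inner ℂ (z : H) (L w) - inner ℂ (z : H) (∑ i ∈ s, (c i : ℂ) • E.proj (S i) w)‖ ≤
      2 * h * ‖(z : H)‖ * ‖(w : H)‖ := by
  classical
  set W := ⋃ i ∈ s, S i with hWdef
  have hW : MeasurableSet W := s.measurableSet_biUnion fun i _ => hS i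
  set D : Submodule ℂ H := LinearMap.eqLocus (E.proj W : H →ₗ[ℂ] H) LinearMap.id with hD
  have hmem : ∀ x, x ∈ D ↔ E.proj W x = x := fun x => Iff.rfl
  have hle : D ≤ L.domain := fun x hx => by
    have := hdom x
    rwa [(hmem x).1 hx] at this
  set G : H →L[ℂ] H := ∑ i ∈ s, (c i : ℂ) • E.proj (S i) with hG
  have hG' : ∀ x, G x = ∑ i ∈ s, (c i : ℂ) • E.proj (S i) x := by simp [hG]
  set N : D →ₗ[ℂ] H := L.toFun ∘ₗ Submodule.inclusion hle - (G : H →ₗ[ℂ] H) ∘ₗ D.subtype with hN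
  have hN' : ∀ x : D, N x = L ⟨x, hle x.2⟩ - G x := fun x => rfl
  -- For `x` in the range of `E.proj W` the scalar measure is carried by `W`, where `f` is within
  -- `h` of the step function; polarization then bounds the sesquilinear form, at the cost of a
  -- factor `2`.
  have hform : ∀ x : D, ‖inner ℂ (x : H) (N x)‖ ≤ h * ‖x‖ ^ 2 := by
    intro x
    have hint := hL.integrable ⟨x, hle x.2⟩
    have h1 := hL.inner_self ⟨x, hle x.2⟩
    have hint2 : ∀ i ∈ s, Integrable ((S i).indicator fun _ => c i) (E.scalarMeasure (x : H)) :=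
      fun i _ => (integrable_const _).indicator (hS i)
    have h2 : inner ℂ (x : H) (G x) =
        ((∫ t, ∑ i ∈ s, (S i).indicator (fun _ => c i) t ∂(E.scalarMeasure (x : H)) : ℝ) : ℂ) := by
      rw [integral_finsetSum _ hint2, hG', inner_sum, Complex.ofReal_sum]
      refine Finset.sum_congr rfl fun i _ => ?_
      rw [integral_indicator_const _ (hS i), E.scalarMeasure_real_apply _ (hS i), inner_smul_right,
        ← (E.isStarProjection _ (hS i)).apply_apply,
        ← (E.isStarProjection _ (hS i)).inner_apply_apply,
        (E.isStarProjection _ (hS i)).apply_apply, inner_self_eq_norm_sq_to_K]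
      simp [mul_comm]
    rw [hN', inner_sub_right, h1, h2, ← Complex.ofReal_sub,
      ← integral_sub hint (integrable_finsetSum _ hint2), Complex.norm_real,
      show ‖x‖ = ‖(x : H)‖ from rfl, ← E.scalarMeasure_real_univ]
    refine norm_integral_le_of_norm_le_const ?_
    filter_upwards [E.ae_mem_of_proj_eq hW x.2] with t ht
    rw [hWdef, Set.mem_iUnion₂] at ht
    obtain ⟨i, hi, hti⟩ := ht
    rw [Finset.sum_eq_single_of_mem i hi, Set.indicator_of_mem hti]
    · exact hc i hi t hti
    · intro j _ hj
      exact Set.indicator_of_notMem (fun htj => (hd hj).le_bot ⟨htj, hti⟩) _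
  have hwD : (w : H) ∈ D := hw
  have hzD : E.proj W z ∈ D := (E.isStarProjection W hW).apply_apply _
  have h1 := norm_inner_le_of_norm_inner_self_le N hform ⟨_, hzD⟩ ⟨_, hwD⟩
  -- Only the component of `z` in the range of `E.proj W` pairs with `L w`, so `z` need not lie in
  -- that range.
  have h2 : inner ℂ (E.proj W z) (L w) = inner ℂ (z : H) (L w) := by
    have h3 := hL.inner_eq_zero hW (v := z - ⟨_, hdom z⟩) (w := w)
      (by simp [(E.isStarProjection W hW).apply_apply]) hw
    rw [Submodule.coe_sub, inner_sub_left, sub_eq_zero] at h3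
    exact h3.symm
  have h4 : inner ℂ (E.proj W z) (G w) = inner ℂ (z : H) (G w) := by
    rw [(E.isStarProjection W hW).inner_apply_apply]
    congr 1
    rw [hG', map_sum]
    refine Finset.sum_congr rfl fun i hi => ?_
    rw [map_smul, E.proj_proj hW (hS i), Set.inter_eq_right.2]
    exact Set.subset_biUnion_of_mem (u := S) hi
  rw [← hG', ← h2, ← h4, ← inner_sub_right]
  refine h1.trans ?_
  have h5 : ‖E.proj W z‖ ≤ ‖(z : H)‖ := E.norm_proj_le hW _
  change 2 * h * ‖E.proj W z‖ * ‖(w : H)‖ ≤ _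
  gcongr

end SpectralMeasure

/-! ### Discretization on a lattice and the transfer of the Schur bound to operators. -/

theorem abs_kappaFun_sub_le (s t : ℝ) : |kappaFun s - kappaFun t| ≤ |s - t| := by
  rw [kappaFun_eq, kappaFun_eq]
  refine (abs_max_sub_max_le_max _ _ _ _).trans ?_
  rw [sub_self, abs_zero, max_eq_right (abs_nonneg _)]
  exact (abs_min_sub_min_le_max _ _ _ _).trans (by simp)

theorem abs_kappaFun_le_one (t : ℝ) : |kappaFun t| ≤ 1 := by
  rw [kappaFun_eq, abs_le]
  exact ⟨le_max_left _ _, max_le (by norm_num) (min_le_right _ _)⟩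

theorem kappaFun_div (N : ℕ) (hN : N ≠ 0) (m : ℤ) : kappaFun (m / N) = clamp N m / N := by
  have hN' : (0 : ℝ) < N := by positivity
  rw [kappaFun_eq, clamp]
  push_cast
  rw [← max_div_div_right hN'.le, ← min_div_div_right hN'.le, neg_div, div_self hN'.ne']

/-- The cells of the lattice of step `1 / N`. -/
def cell (N : ℕ) (m : ℤ) : Set ℝ := Set.Ico (m / N) ((m + 1) / N)

theorem measurableSet_cell (N : ℕ) (m : ℤ) : MeasurableSet (cell N m) := measurableSet_Ico

theorem mem_cell_iff {N : ℕ} (hN : N ≠ 0) {m : ℤ} {t : ℝ} : t ∈ cell N m ↔ ⌊t * N⌋ = m := by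
  have hN' : (0 : ℝ) < N := by positivity
  rw [cell, Set.mem_Ico, div_le_iff₀ hN', lt_div_iff₀ hN', Int.floor_eq_iff]

theorem pairwise_disjoint_cell {N : ℕ} (hN : N ≠ 0) :
    Pairwise (Function.onFun Disjoint (cell N)) := fun m n hmn => by
  rw [Function.onFun, Set.disjoint_left]
  intro t h1 h2
  rw [mem_cell_iff hN] at h1 h2
  exact hmn (h1.symm.trans h2)

theorem iUnion_cell {N : ℕ} (hN : N ≠ 0) : ⋃ m, cell N m = Set.univ :=
  Set.eq_univ_of_forall fun t => Set.mem_iUnion.2 ⟨⌊t * N⌋, (mem_cell_iff hN).2 rfl⟩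

theorem abs_sub_le_of_mem_cell {N : ℕ} {m : ℤ} {t : ℝ} (ht : t ∈ cell N m) :
    |t - m / N| ≤ 1 / N := by
  obtain ⟨h1, h2⟩ := ht
  rw [add_div] at h2
  rw [abs_le]
  have : (0 : ℝ) ≤ 1 / N := by positivity
  constructor <;> linarith

namespace SpectralMeasure

variable {H : Type u} [NormedAddCommGroup H] [InnerProductSpace ℂ H] [CompleteSpace H]
  {E F : SpectralMeasure H}

/-- Permits restriction to finitely many cells, where spectral sums are finite and vectors lie in
the operator domains. -/
theorem tendsto_proj_cell (E : SpectralMeasure H) {N : ℕ} (hN : N ≠ 0) (x : H) :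
    Filter.Tendsto (fun s : Finset ℤ => E.proj (⋃ m ∈ s, cell N m) x) Filter.atTop (nhds x) := by
  obtain ⟨e⟩ : Nonempty (ℕ ≃ ℤ) := ⟨(Denumerable.eqv ℤ).symm⟩
  have h1 := E.hasSum_proj (fun n => cell N (e n)) (fun n => measurableSet_cell N _)
    (fun m n hmn => pairwise_disjoint_cell hN (e.injective.ne hmn)) x
  rw [e.surjective.iUnion_comp (cell N), iUnion_cell hN, E.proj_univ] at h1
  have h2 : HasSum (fun m => E.proj (cell N m) x) x :=
    (e.hasSum_iff (f := fun m => E.proj (cell N m) x)).1 h1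
  refine Filter.Tendsto.congr (fun s => ?_) h2
  exact (E.proj_biUnion s (measurableSet_cell N) (pairwise_disjoint_cell hN) x).symm

theorem IsSpectralMeasureOf.isFormOf {A : H →ₗ.[ℂ] H} (h : E.IsSpectralMeasureOf A) :
    E.IsFormOf (fun t => t) A where
  integrable x := by
    have h1 : Integrable (fun t : ℝ => t ^ 2 + 1) (E.scalarMeasure (x : H)) :=
      ((h.1 x).1 x.2).add (integrable_const 1)
    refine h1.mono' measurable_id.aestronglyMeasurable (ae_of_all _ fun t => ?_)
    rw [Real.norm_eq_abs, abs_le]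
    constructor <;> nlinarith [sq_nonneg (t - 1), sq_nonneg (t + 1)]
  inner_self := h.2

theorem IsSpectralMeasureOf.proj_cell_mem {A : H →ₗ.[ℂ] H} (h : E.IsSpectralMeasureOf A) (N : ℕ)
    (s : Finset ℤ) (x : H) : E.proj (⋃ m ∈ s, cell N m) x ∈ A.domain := by
  have hW : MeasurableSet (⋃ m ∈ s, cell N m) :=
    s.measurableSet_biUnion fun m _ => measurableSet_cell N m
  rw [h.1]
  refine Integrable.mono' (integrable_const (∑ m ∈ s, (|(m : ℝ) / N| + 1 / N) ^ 2))
    (by fun_prop) ?_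
  filter_upwards [E.ae_mem_of_proj_eq hW ((E.isStarProjection _ hW).apply_apply x)] with t ht
  rw [Set.mem_iUnion₂] at ht
  obtain ⟨m, hm, htm⟩ := ht
  have h1 := abs_sub_le_of_mem_cell htm
  have h2 : |t| ≤ |(m : ℝ) / N| + 1 / N := by
    have := abs_add_le (t - m / N) ((m : ℝ) / N)
    rw [sub_add_cancel] at this
    linarith
  rw [norm_pow, Real.norm_eq_abs]
  refine (pow_le_pow_left₀ (abs_nonneg t) h2 2).trans ?_
  exact Finset.single_le_sum (f := fun m : ℤ => (|(m : ℝ) / N| + 1 / N) ^ 2)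
    (fun m _ => by positivity) hm

/-- Places `κ(A)` in the same framework as `A`, so that one comparison lemma serves both. -/
theorem isFormOf_of_inner_self (f : ℝ →ᵇ ℝ) (T : H →L[ℂ] H)
    (h : ∀ x : H, inner ℂ x (T x) = ((∫ t, f t ∂(E.scalarMeasure x) : ℝ) : ℂ)) :
    E.IsFormOf f ((T : H →ₗ[ℂ] H).toPMap ⊤) where
  integrable _ := f.integrable _
  inner_self x := h x

/-- Truncated and discretized comparison of functions of two operators. -/
theorem norm_inner_sub_sub_le {f : ℝ → ℝ} {L M : H →ₗ.[ℂ] H} (hL : E.IsFormOf f L)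
    (hM : F.IsFormOf f M) (hf : ∀ s t, |f s - f t| ≤ |s - t|) {N : ℕ} (hN : N ≠ 0)
    (s : Finset ℤ) (hLd : ∀ x, E.proj (⋃ m ∈ s, cell N m) x ∈ L.domain)
    (hMd : ∀ x, F.proj (⋃ m ∈ s, cell N m) x ∈ M.domain) (hLM : L.domain = M.domain) {x y : H}
    (hx : E.proj (⋃ m ∈ s, cell N m) x = x) (hy : F.proj (⋃ m ∈ s, cell N m) y = y)
    (hxL : x ∈ L.domain) (hyM : y ∈ M.domain) :
    ‖inner ℂ x (L ⟨y, hLM ▸ hyM⟩ - M ⟨y, hyM⟩) - inner ℂ x (schurProd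
      (fun m : s => E.proj (cell N m)) (fun n : s => F.proj (cell N n))
      (fun m n => f (m / N) - f (n / N)) 1 y)‖ ≤ 4 / N * ‖x‖ * ‖y‖ := by
  have hc : ∀ i ∈ s, ∀ t ∈ cell N i, |f t - f (i / N)| ≤ 1 / N := fun i _ t ht =>
    (hf _ _).trans (abs_sub_le_of_mem_cell ht)
  have hyL : y ∈ L.domain := hLM ▸ hyM
  have h1 := hL.norm_inner_sub_le (measurableSet_cell N) (pairwise_disjoint_cell hN) hc hLd
    ⟨y, hyL⟩ ⟨x, hxL⟩ hx (by positivity)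
  have h2 := hM.norm_inner_sub_le (measurableSet_cell N) (pairwise_disjoint_cell hN) hc hMd
    ⟨x, hLM ▸ hxL⟩ ⟨y, hyM⟩ hy (by positivity)
  simp only at h1 h2
  have hsx : ∑ i ∈ s, E.proj (cell N i) x = x := by
    rw [← E.proj_biUnion s (measurableSet_cell N) (pairwise_disjoint_cell hN), hx]
  have hsy : ∑ i ∈ s, F.proj (cell N i) y = y := by
    rw [← F.proj_biUnion s (measurableSet_cell N) (pairwise_disjoint_cell hN), hy]
  have hp : ∀ i u v, inner ℂ (E.proj (cell N i) u) v = inner ℂ u (E.proj (cell N i) v) :=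
    fun i => (E.isStarProjection _ (measurableSet_cell N i)).inner_apply_apply
  -- Since the cell projections sum to the identity on `x` and on `y`, the row part of the kernel
  -- gives the step function of the first operator and the column part that of the second.
  have h3 : inner ℂ x (schurProd
      (fun m : s => E.proj (cell N m)) (fun n : s => F.proj (cell N n))
      (fun m n => f (m / N) - f (n / N)) 1 y) =
      inner ℂ (∑ i ∈ s, (f (i / N) : ℂ) • E.proj (cell N i) x) y -
      inner ℂ x (∑ i ∈ s, (f (i / N) : ℂ) • F.proj (cell N i) y) := by
    have e1 : ∀ m n : ℤ, inner ℂ x (((f (m / N) - f (n / N) : ℝ) : ℂ) •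
        (E.proj (cell N m) (F.proj (cell N n) y))) =
        inner ℂ ((f (m / N) : ℂ) • E.proj (cell N m) x) (F.proj (cell N n) y) -
        inner ℂ (E.proj (cell N m) x) ((f (n / N) : ℂ) • F.proj (cell N n) y) := by
      intro m n
      rw [inner_smul_right, inner_smul_left, inner_smul_right, hp, Complex.conj_ofReal]
      push_cast
      ring
    have e2 : inner ℂ (∑ i ∈ s, (f (i / N) : ℂ) • E.proj (cell N i) x) y =
        ∑ m ∈ s, ∑ n ∈ s, inner ℂ ((f (m / N) : ℂ) • E.proj (cell N m) x)
          (F.proj (cell N n) y) := by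
      rw [sum_inner]
      refine Finset.sum_congr rfl fun m _ => ?_
      rw [← inner_sum, hsy]
    have e3 : inner ℂ x (∑ i ∈ s, (f (i / N) : ℂ) • F.proj (cell N i) y) =
        ∑ m ∈ s, ∑ n ∈ s, inner ℂ (E.proj (cell N m) x)
          ((f (n / N) : ℂ) • F.proj (cell N n) y) := by
      rw [← hsx, sum_inner, hsx]
      refine Finset.sum_congr rfl fun m _ => ?_
      rw [inner_sum]
    rw [e2, e3, ← Finset.sum_sub_distrib]
    simp only [← Finset.sum_sub_distrib, ← e1]
    simp only [schurProd, mul_one, sum_apply, smul_apply,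
      mul_apply_eq_comp, inner_sum]
    rw [← Finset.sum_coe_sort s]
    exact Finset.sum_congr rfl fun m _ => (Finset.sum_coe_sort s fun n =>
      inner ℂ x (((f (m / N) - f (n / N) : ℝ) : ℂ) • (E.proj (cell N m) (F.proj (cell N n) y))))
  -- The vector `y` lies in a spectral subspace of `F`, not of `E`; symmetry moves `L` onto `x`,
  -- where its step function is a good approximation.
  have h4 : inner ℂ x (L ⟨y, hyL⟩) = inner ℂ (L ⟨x, hxL⟩) y :=
    (hL.inner_apply ⟨x, hxL⟩ ⟨y, hyL⟩).symm
  have h5 : ‖inner ℂ (L ⟨x, hxL⟩) y -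
      inner ℂ (∑ i ∈ s, (f (i / N) : ℂ) • E.proj (cell N i) x) y‖ ≤ 2 * (1 / N) * ‖y‖ * ‖x‖ := by
    refine le_of_eq_of_le ?_ h1
    rw [← inner_sub_left, ← inner_sub_right, norm_inner_symm]
  rw [h3, inner_sub_right, h4]
  calc _ = ‖(inner ℂ (L ⟨x, hxL⟩) y -
      inner ℂ (∑ i ∈ s, (f (i / N) : ℂ) • E.proj (cell N i) x) y) -
      (inner ℂ x (M ⟨y, hyM⟩) - inner ℂ x (∑ i ∈ s, (f (i / N) : ℂ) • F.proj (cell N i) y))‖ := by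
        congr 1
        ring
    _ ≤ 2 * (1 / N) * ‖y‖ * ‖x‖ + 2 * (1 / N) * ‖x‖ * ‖y‖ := norm_sub_le_of_le h5 h2
    _ = _ := by ring

/-- The rounded difference `T` has norm at most `δ + 4 / N`, the divided difference multiplies this
by `4 * loglog (2 * N) + 40`, and returning to `κ(A) - κ(B)` costs another `4 / N`. -/
theorem norm_sub_le_of_isSpectralMeasureOf {A B : H →ₗ.[ℂ] H} {fA fB : H →L[ℂ] H} {δ : ℝ}
    (hδ : 0 ≤ δ) (hAB : NormSubLE A B δ) (hE : E.IsSpectralMeasureOf A)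
    (hF : F.IsSpectralMeasureOf B)
    (hfA : ∀ x : H, inner ℂ x (fA x) = ((∫ t, kappa t ∂(E.scalarMeasure x) : ℝ) : ℂ))
    (hfB : ∀ x : H, inner ℂ x (fB x) = ((∫ t, kappa t ∂(F.scalarMeasure x) : ℝ) : ℂ))
    {N : ℕ} (hN : N ≠ 0) :
    ‖fA - fB‖ ≤ (4 * loglog (2 * N) + 40) * (4 / N + δ) + 4 / N := by
  have hN' : (0 : ℝ) < N := by positivity
  set C : ℝ := 4 * loglog (2 * N) + 40 with hC
  have hC0 : 0 ≤ C := by positivity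
  refine ContinuousLinearMap.norm_le_of_norm_inner_le (by positivity) fun x y => ?_
  have hlim : Filter.Tendsto (fun s : Finset ℤ => ‖inner ℂ (E.proj (⋃ m ∈ s, cell N m) x)
      ((fA - fB) (F.proj (⋃ m ∈ s, cell N m) y))‖) Filter.atTop
      (nhds ‖inner ℂ x ((fA - fB) y)‖) :=
    ((E.tendsto_proj_cell hN x).inner
      (((fA - fB).continuous.tendsto y).comp (F.tendsto_proj_cell hN y))).norm
  refine le_of_tendsto' hlim fun s => ?_
  set W := ⋃ m ∈ s, cell N m with hWdef
  have hW : MeasurableSet W := s.measurableSet_biUnion fun m _ => measurableSet_cell N m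
  set P : s → H →L[ℂ] H := fun m => E.proj (cell N m) with hPdef
  set Q : s → H →L[ℂ] H := fun m => F.proj (cell N m) with hQdef
  have hd : Pairwise (Function.onFun Disjoint fun m : s => cell N m) := fun m n hmn =>
    pairwise_disjoint_cell hN (Subtype.coe_injective.ne hmn)
  have hP : IsOrthogonalProjections P :=
    E.isOrthogonalProjections (fun _ => measurableSet_cell N _) hd
  have hQ : IsOrthogonalProjections Q :=
    F.isOrthogonalProjections (fun _ => measurableSet_cell N _) hd
  have hEW : ∀ x, E.proj W (E.proj W x) = E.proj W x := (E.isStarProjection W hW).apply_apply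
  have hFW : ∀ x, F.proj W (F.proj W x) = F.proj W x := (F.isStarProjection W hW).apply_apply
  set T := schurProd P Q (fun m n => ((m : ℤ) : ℝ) / N - ((n : ℤ) : ℝ) / N) 1 with hT
  set X := schurProd P Q (fun m n => kappaFun ((m : ℤ) / N) - kappaFun ((n : ℤ) / N)) 1 with hX
  -- The value of the divided difference at `m = n` is irrelevant, because the kernel of `T`
  -- vanishes there.
  have hXT : X = schurProd P Q (fun m n => dividedDiff (fun k => clamp N k) m n) T := by
    rw [hT, schurProd_schurProd hP hQ, hX]
    congr 1
    funext m n
    rw [kappaFun_div N hN, kappaFun_div N hN, dividedDiff, ← sub_div, ← sub_div, mul_div_assoc']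
    congr 1
    rcases eq_or_ne (m : ℤ) n with h | h
    · simp [h]
    · rw [div_mul_cancel₀]
      rw [sub_ne_zero]
      exact_mod_cast h
  have hcell : ∀ m : s, cell N m ⊆ W := fun m => Set.subset_biUnion_of_mem (u := cell N) m.2
  -- `T` only sees the components in the ranges of the two projections on `W`, so its norm can be
  -- tested on vectors in the domains of `A` and `B`.
  have hTx : ∀ x y, inner ℂ x (T y) = inner ℂ (E.proj W x) (T (F.proj W y)) := by
    intro x y
    rw [(E.isStarProjection W hW).inner_apply_apply]
    congr 1
    simp only [hT, schurProd, sum_apply, smul_apply, mul_one,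
      mul_apply_eq_comp, map_sum, map_smul]
    refine Finset.sum_congr rfl fun m _ => Finset.sum_congr rfl fun n _ => ?_
    rw [E.proj_proj hW (measurableSet_cell N _), F.proj_proj (measurableSet_cell N _) hW,
      Set.inter_eq_right.2 (hcell m), Set.inter_eq_left.2 (hcell n)]
  have hTnorm : ‖T‖ ≤ 4 / N + δ := by
    refine ContinuousLinearMap.norm_le_of_norm_inner_le (by positivity) fun x y => ?_
    rw [hTx]
    have hxA := hE.proj_cell_mem N s x
    have hyB := hF.proj_cell_mem N s y
    have h1 := norm_inner_sub_sub_le hE.isFormOf hF.isFormOf (fun _ _ => le_rfl) hN s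
      (hE.proj_cell_mem N s) (hF.proj_cell_mem N s) hAB.1 (hEW x) (hFW y) hxA hyB
    have h2 := hAB.2 (F.proj W y) (hAB.1 ▸ hyB) hyB
    have h3 : ‖inner ℂ (E.proj W x) (A ⟨F.proj W y, hAB.1 ▸ hyB⟩ - B ⟨F.proj W y, hyB⟩)‖ ≤
        ‖E.proj W x‖ * (δ * ‖F.proj W y‖) :=
      (norm_inner_le_norm _ _).trans (by gcongr)
    have h4 := norm_sub_norm_le (inner ℂ (E.proj W x) (T (F.proj W y)))
      (inner ℂ (E.proj W x) (A ⟨F.proj W y, hAB.1 ▸ hyB⟩ - B ⟨F.proj W y, hyB⟩))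
    rw [norm_sub_rev] at h4
    have h5 : ‖inner ℂ (E.proj W x) (T (F.proj W y))‖ ≤
        (4 / N + δ) * (‖E.proj W x‖ * ‖F.proj W y‖) := by
      have := h4.trans h1
      linarith
    rw [mul_assoc]
    refine h5.trans ?_
    gcongr
    · exact E.norm_proj_le hW x
    · exact F.norm_proj_le hW y
  have hXnorm : ‖X‖ ≤ C * (4 / N + δ) := by
    rw [hXT]
    refine (SchurLE.dividedDiff_clamp hP hQ _ _ hN T).trans ?_
    gcongr
  have h1 := norm_inner_sub_sub_le (isFormOf_of_inner_self kappa fA hfA)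
    (isFormOf_of_inner_self kappa fB hfB) abs_kappaFun_sub_le hN s
    (fun _ => trivial) (fun _ => trivial) rfl (hEW x) (hFW y) trivial trivial
  change ‖inner ℂ (E.proj W x) ((fA - fB) (F.proj W y)) -
    inner ℂ (E.proj W x) (X (F.proj W y))‖ ≤ _ at h1
  have h2 : ‖inner ℂ (E.proj W x) (X (F.proj W y))‖ ≤
      ‖E.proj W x‖ * (C * (4 / N + δ) * ‖F.proj W y‖) :=
    (norm_inner_le_norm _ _).trans (by gcongr; exact X.le_of_opNorm_le hXnorm _)
  have h4 := norm_sub_norm_le (inner ℂ (E.proj W x) ((fA - fB) (F.proj W y)))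
    (inner ℂ (E.proj W x) (X (F.proj W y)))
  have h5 : ‖inner ℂ (E.proj W x) ((fA - fB) (F.proj W y))‖ ≤
      (C * (4 / N + δ) + 4 / N) * (‖E.proj W x‖ * ‖F.proj W y‖) := by
    have := h4.trans h1
    linarith
  rw [mul_assoc]
  refine h5.trans ?_
  gcongr
  · exact E.norm_proj_le hW x
  · exact F.norm_proj_le hW y

end SpectralMeasure

/-! ### Diagonal operators as admissible pairs for the operator modulus. -/

section Diagonal

variable {ι : Type*} [Fintype ι] {H : Type u} [NormedAddCommGroup H] [InnerProductSpace ℂ H]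

/-- The operator with real eigenvalues `a i` and eigenvectors `b i`. -/
noncomputable def OrthonormalBasis.diag (b : OrthonormalBasis ι ℂ H) (a : ι → ℝ) : H →L[ℂ] H :=
  ∑ i, (a i : ℂ) • (innerSL ℂ (b i)).smulRight (b i)

namespace OrthonormalBasis

variable (b : OrthonormalBasis ι ℂ H) (a : ι → ℝ)

theorem ext_inner_left {x y : H} (h : ∀ i, inner ℂ (b i) x = inner ℂ (b i) y) : x = y := by
  rw [← b.sum_repr' x, ← b.sum_repr' y]
  simp only [h]

theorem diag_apply (x : H) : b.diag a x = ∑ i, (a i : ℂ) • inner ℂ (b i) x • b i := by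
  simp [diag]

theorem inner_diag_right (i : ι) (x : H) : inner ℂ (b i) (b.diag a x) = a i * inner ℂ (b i) x := by
  classical
  simp [diag_apply, orthonormal_iff_ite.1 b.orthonormal]

theorem inner_self_diag (x : H) :
    inner ℂ x (b.diag a x) = ((∑ i, ‖inner ℂ (b i) x‖ ^ 2 * a i : ℝ) : ℂ) := by
  rw [← b.sum_inner_mul_inner]
  push_cast
  refine Finset.sum_congr rfl fun i _ => ?_
  rw [inner_diag_right, ← Complex.conj_mul', inner_conj_symm]
  ring

theorem diag_mul (a' : ι → ℝ) : b.diag a * b.diag a' = b.diag fun i => a i * a' i := by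
  refine ContinuousLinearMap.ext fun x => b.ext_inner_left fun i => ?_
  rw [mul_apply_eq_comp, inner_diag_right, inner_diag_right, inner_diag_right]
  push_cast
  ring

theorem isSelfAdjoint_diag [CompleteSpace H] : IsSelfAdjoint (b.diag a) := by
  rw [ContinuousLinearMap.isSelfAdjoint_iff_isSymmetric,
    LinearMap.isSymmetric_iff_inner_map_self_real]
  intro x
  have h : inner ℂ (b.diag a x) x = ((∑ i, ‖inner ℂ (b i) x‖ ^ 2 * a i : ℝ) : ℂ) := by
    rw [← inner_conj_symm, b.inner_self_diag a x, Complex.conj_ofReal]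
  rw [ContinuousLinearMap.coe_coe, h, Complex.conj_ofReal]

theorem diag_const (c : ℝ) : b.diag (fun _ => c) = (c : ℂ) • 1 := by
  refine ContinuousLinearMap.ext fun x => b.ext_inner_left fun i => ?_
  rw [inner_diag_right, smul_apply, inner_smul_right]
  rfl

/-- One unitary conjugates every function of the operator: applied to `a` and to `κ ∘ a`, this gives
`U A U⁻¹` and `U κ(A) U⁻¹`. -/
theorem diag_map (U : H ≃ₗᵢ[ℂ] H) (x : H) : (b.map U).diag a x = U (b.diag a (U.symm x)) := by
  refine (b.map U).ext_inner_left fun i => ?_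
  rw [inner_diag_right, OrthonormalBasis.map_apply, LinearIsometryEquiv.inner_map_map, inner_diag_right]
  congr 1
  rw [← U.inner_map_map (b i), U.apply_symm_apply]

variable [CompleteSpace H]

/-- The spectral measure of `b.diag a`. -/
noncomputable def spectralMeasure : SpectralMeasure H where
  proj S := b.diag fun i => S.indicator (fun _ => 1) (a i)
  isStarProjection S _ := ⟨by
    rw [IsIdempotentElem, diag_mul]
    congr 1
    funext i
    by_cases h : a i ∈ S <;> simp [h], b.isSelfAdjoint_diag _⟩
  proj_univ := by simp [diag_const]
  hasSum_proj S _ hd x := by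
    simp only [diag_apply]
    refine hasSum_sum fun i _ => ?_
    have h : HasSum (fun n => (S n).indicator (fun _ => (1 : ℝ)) (a i))
        ((⋃ n, S n).indicator (fun _ => 1) (a i)) := by
      by_cases hi : ∃ n, a i ∈ S n
      · obtain ⟨n, hn⟩ := hi
        rw [Set.indicator_of_mem (Set.mem_iUnion.2 ⟨n, hn⟩)]
        convert hasSum_single n fun m hm => ?_ using 1
        · rw [Set.indicator_of_mem hn]
        · exact Set.indicator_of_notMem (fun h => (hd hm).le_bot ⟨h, hn⟩) _
      · rw [Set.indicator_of_notMem (by simpa using hi)]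
        push Not at hi
        simp only [Set.indicator_of_notMem (hi _)]
        exact hasSum_zero
    exact (Complex.hasSum_ofReal.2 h).smul_const _

theorem scalarMeasure_spectralMeasure (x : H) :
    (b.spectralMeasure a).scalarMeasure x =
      ∑ i, ENNReal.ofReal (‖inner ℂ (b i) x‖ ^ 2) • Measure.dirac (a i) := by
  ext S hS
  rw [SpectralMeasure.scalarMeasure_apply _ _ hS, ← SpectralMeasure.re_inner_proj _ hS]
  change ENNReal.ofReal (inner ℂ x (b.diag _ x)).re = _
  rw [inner_self_diag, Complex.ofReal_re, ENNReal.ofReal_sum_of_nonneg]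
  · rw [Measure.coe_finsetSum, Finset.sum_apply]
    refine Finset.sum_congr rfl fun i _ => ?_
    rw [Measure.smul_apply, Measure.dirac_apply' _ hS, ENNReal.ofReal_mul (by positivity)]
    by_cases h : a i ∈ S <;> simp [h]
  · intro i _
    exact mul_nonneg (by positivity) (Set.indicator_nonneg (fun _ _ => zero_le_one) _)

theorem integrable_scalarMeasure (x : H) (f : ℝ → ℝ) :
    Integrable f ((b.spectralMeasure a).scalarMeasure x) := by
  rw [scalarMeasure_spectralMeasure, integrable_finsetSum_measure]
  exact fun i _ => (integrable_dirac (by simp)).smul_measure ENNReal.ofReal_ne_top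

theorem integral_scalarMeasure (x : H) (f : ℝ → ℝ) :
    ∫ t, f t ∂(b.spectralMeasure a).scalarMeasure x = ∑ i, ‖inner ℂ (b i) x‖ ^ 2 * f (a i) := by
  rw [scalarMeasure_spectralMeasure, integral_finsetSum_measure]
  · refine Finset.sum_congr rfl fun i _ => ?_
    rw [integral_smul_measure, integral_dirac, ENNReal.toReal_ofReal (by positivity), smul_eq_mul]
  · exact fun i _ => (integrable_dirac (by simp)).smul_measure ENNReal.ofReal_ne_top

/-- `b.diag a` as an everywhere defined operator. -/
noncomputable def diagPMap : H →ₗ.[ℂ] H := (b.diag a : H →ₗ[ℂ] H).toPMap ⊤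

theorem isSelfAdjoint_diagPMap : IsSelfAdjoint (b.diagPMap a) := by
  rw [LinearPMap.isSelfAdjoint_def, diagPMap,
    ContinuousLinearMap.toPMap_adjoint_eq_adjoint_toPMap_of_dense _ (by simp),
    ContinuousLinearMap.isSelfAdjoint_iff'.1 (b.isSelfAdjoint_diag a)]

theorem isFunctionOf_diag (f : ℝ →ᵇ ℝ) :
    IsFunctionOf f (b.diagPMap a) (b.diag fun i => f (a i)) := by
  refine ⟨b.spectralMeasure a, ⟨fun x => ?_, fun x => ?_⟩, fun x => ?_⟩
  · exact iff_of_true trivial (b.integrable_scalarMeasure a _ _)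
  · rw [integral_scalarMeasure]
    exact b.inner_self_diag a x
  · rw [integral_scalarMeasure]
    exact b.inner_self_diag _ x

theorem enorm_sub_le_operatorModulus (b' : OrthonormalBasis ι ℂ H) (a' : ι → ℝ) (f : ℝ →ᵇ ℝ) {δ : ℝ}
    (h : ‖b.diag a - b'.diag a'‖ ≤ δ) :
    ‖(b.diag fun i => f (a i)) - b'.diag fun i => f (a' i)‖ₑ ≤ operatorModulus.{u} f δ := by
  refine le_sSup ⟨H, inferInstance, inferInstance, inferInstance, b.diagPMap a, b'.diagPMap a',
    _, _, b.isSelfAdjoint_diagPMap a, b'.isSelfAdjoint_diagPMap a', ⟨rfl, fun x _ _ => ?_⟩,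
    b.isFunctionOf_diag a f, b'.isFunctionOf_diag a' f, rfl⟩
  exact (b.diag a - b'.diag a').le_of_opNorm_le h x

end OrthonormalBasis

end Diagonal

/-! ### From commutators to differences by the Cayley transform. -/

section Cayley

variable {H : Type u} [NormedAddCommGroup H] [InnerProductSpace ℂ H] [CompleteSpace H]

/-- The Cayley transform of a self-adjoint contraction: a unitary whose commutators are comparable
with those of the operator. -/
theorem exists_unitary_commutator {R : H →L[ℂ] H} (hR : IsSelfAdjoint R) (hR1 : ‖R‖ ≤ 1) :
    ∃ U : H ≃ₗᵢ[ℂ] H, ∀ D D' : H →L[ℂ] H, (∀ x, D' x = U (D (U.symm x))) →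
      ‖D - D'‖ ≤ 2 * ‖R * D - D * R‖ ∧ ‖R * D - D * R‖ ≤ 2 * ‖D - D'‖ := by
  set V : H →L[ℂ] H := 1 - Complex.I • R with hV
  have hVstar : star V = 1 + Complex.I • R := by
    rw [hV, star_sub, star_one, star_smul, hR.star_eq, Complex.star_def, Complex.conj_I]
    simp
  have hunit : IsUnit V := by
    have h1 : -Complex.I ∉ spectrum ℂ R := by
      intro h
      have h2 := hR.mem_spectrum_eq_re h
      have h3 := congrArg Complex.im h2
      simp at h3
    rw [spectrum.notMem_iff] at h1
    have h2 : V = algebraMap ℂ (H →L[ℂ] H) Complex.I *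
        (algebraMap ℂ (H →L[ℂ] H) (-Complex.I) - R) := by
      rw [mul_sub, ← map_mul, ← Algebra.smul_def]
      simp [hV]
    rw [h2]
    exact ((IsUnit.mk0 _ Complex.I_ne_zero).map _).mul h1
  obtain ⟨v, hv⟩ := hunit
  set Z : H →L[ℂ] H := ↑v⁻¹ with hZ
  have hVZ : V * Z = 1 := by rw [← hv]; exact v.mul_inv
  have hZV : Z * V = 1 := by rw [← hv]; exact v.inv_mul
  -- The real part of `⟪x, V x⟫` is `‖x‖ ^ 2`, as `R` is self-adjoint; hence the inverse of `V` is a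
  -- contraction.
  have hlow : ∀ x, ‖x‖ ≤ ‖V x‖ := by
    intro x
    have h1 : (inner ℂ x (V x)).re = ‖x‖ ^ 2 := by
      have h2 : (inner ℂ x (R x)).im = 0 := by
        have h3 := hR.isSymmetric x x
        rw [ContinuousLinearMap.coe_coe, ← inner_conj_symm] at h3
        exact Complex.conj_eq_iff_im.1 h3
      have h4 : (inner ℂ x x).re = ‖x‖ ^ 2 := inner_self_eq_norm_sq (𝕜 := ℂ) x
      rw [hV]
      rw [sub_apply, smul_apply, inner_sub_right, inner_smul_right, Complex.sub_re, one_apply_eq_self,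
        h4, Complex.mul_re, h2]
      simp
    have h5 : (inner ℂ x (V x)).re ≤ ‖x‖ * ‖V x‖ :=
      (Complex.re_le_norm _).trans (norm_inner_le_norm _ _)
    by_contra! hc
    nlinarith [norm_nonneg (V x)]
  have hZn : ‖Z‖ ≤ 1 := by
    refine Z.opNorm_le_bound zero_le_one fun x => ?_
    rw [one_mul]
    refine (hlow (Z x)).trans (le_of_eq ?_)
    rw [← mul_apply_eq_comp, hVZ]
    rfl
  have hVn : ‖V‖ ≤ 2 := by
    refine (norm_sub_le _ _).trans ?_
    rw [norm_smul, Complex.norm_I, one_mul]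
    have : ‖(1 : H →L[ℂ] H)‖ ≤ 1 := ContinuousLinearMap.norm_id_le
    linarith
  have hcomm : star V * V = V * star V := by
    rw [hVstar, hV]
    simp only [mul_add, mul_sub, add_mul, sub_mul, one_mul, mul_one]
    abel
  have hstar2 : star V = 2 - V := by
    rw [hVstar, hV, ← one_add_one_eq_two]
    abel
  set W : H →L[ℂ] H := star V * Z with hW
  have hstarZ : star Z * star V = 1 := by rw [← star_mul, hVZ, star_one]
  have hstarZ' : star V * star Z = 1 := by rw [← star_mul, hZV, star_one]
  have hW' : W = Z * star V := by
    calc W = Z * V * star V * Z := by rw [hZV, one_mul]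
      _ = Z * (star V * V) * Z := by rw [hcomm, mul_assoc Z]
      _ = Z * star V * (V * Z) := by noncomm_ring
      _ = Z * star V := by rw [hVZ, mul_one]
  have hWu : W ∈ unitary (H →L[ℂ] H) := by
    rw [Unitary.mem_iff]
    constructor
    · calc star W * W = star Z * (V * Z) * star V := by
            rw [hW, star_mul, star_star, ← hW, hW']; noncomm_ring
        _ = 1 := by rw [hVZ, mul_one, hstarZ]
    · calc W * star W = star V * (Z * V) * star Z := by
            rw [hW', star_mul, star_star, ← hW', hW]; noncomm_ring
        _ = 1 := by rw [hZV, mul_one, hstarZ']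
  -- Commutators with `W` are therefore twice those with `Z = V⁻¹`, and these are commutators with
  -- `V` multiplied by `Z` on both sides.
  have hW2 : W = 2 * Z - 1 := by rw [hW, hstar2, sub_mul, hVZ]
  refine ⟨Unitary.linearIsometryEquiv ⟨W, hWu⟩, fun D D' hD => ?_⟩
  have h1 : D' * W = W * D := by
    refine ContinuousLinearMap.ext fun x => ?_
    have h := hD (Unitary.linearIsometryEquiv ⟨W, hWu⟩ x)
    rw [LinearIsometryEquiv.symm_apply_apply] at h
    exact h
  have h2 : ‖D - D'‖ = 2 * ‖D * Z - Z * D‖ := by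
    rw [← CStarRing.norm_mul_coe_unitary (D - D') ⟨W, hWu⟩]
    change ‖(D - D') * W‖ = _
    rw [sub_mul, h1, hW2, show D * (2 * Z - 1) - (2 * Z - 1) * D = (2 : ℂ) • (D * Z - Z * D) by
      rw [two_smul]; noncomm_ring, norm_smul]
    simp
  have h3 : D * Z - Z * D = Z * (V * D - D * V) * Z := by
    calc D * Z - Z * D = Z * V * D * Z - Z * D * (V * Z) := by rw [hZV, hVZ, one_mul, mul_one]
      _ = _ := by noncomm_ring
  have h4 : V * D - D * V = V * (D * Z - Z * D) * V := by
    calc V * D - D * V = V * D * (Z * V) - V * Z * D * V := by rw [hZV, hVZ, one_mul, mul_one]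
      _ = _ := by noncomm_ring
  have h5 : ‖V * D - D * V‖ = ‖R * D - D * R‖ := by
    have : V * D - D * V = -Complex.I • (R * D - D * R) := by
      rw [hV, sub_mul, mul_sub, one_mul, mul_one, smul_mul_assoc, mul_smul_comm, smul_sub, neg_smul,
        neg_smul]
      abel
    rw [this, norm_smul, norm_neg, Complex.norm_I, one_mul]
  rw [h2, ← h5]
  constructor
  · gcongr
    rw [h3]
    calc _ ≤ ‖Z‖ * ‖V * D - D * V‖ * ‖Z‖ := norm_mul₃_le
      _ ≤ 1 * ‖V * D - D * V‖ * 1 := by gcongr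
      _ = _ := by ring
  · rw [h4]
    calc _ ≤ ‖V‖ * ‖D * Z - Z * D‖ * ‖V‖ := norm_mul₃_le
      _ ≤ 2 * ‖D * Z - Z * D‖ * 2 := by gcongr
      _ = _ := by ring

end Cayley

/-! ### Hilbert's inequality by Fourier series. -/

section Hilbert

open Complex

theorem integral_exp_two_pi_int (n : ℤ) :
    ∫ t in (0 : ℝ)..1, exp (2 * Real.pi * I * n * t) = if n = 0 then 1 else 0 := by
  split_ifs with h
  · simp [h]
  · have hc : 2 * Real.pi * I * n ≠ 0 := by
      simp [Real.pi_ne_zero, h]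
    rw [integral_exp_mul_complex hc]
    have h1 : exp (2 * Real.pi * I * n * (1 : ℝ)) = 1 := by
      rw [← exp_int_mul_two_pi_mul_I n]
      congr 1
      push_cast
      ring
    rw [h1]
    simp

/-- These are the Fourier coefficients of the sawtooth `t - 1 / 2`. At `n = 0` both sides vanish:
the sawtooth has mean zero and the inverse of `0` is `0`. -/
theorem inv_int_eq_integral (n : ℤ) : (n : ℂ)⁻¹ =
    -(2 * Real.pi * I) * ∫ t in (0 : ℝ)..1, exp (2 * Real.pi * I * (-n : ℤ) * t) *
      ((t - 1 / 2 : ℝ) : ℂ) := by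
  have h := bernoulliFourierCoeff_eq one_ne_zero n
  rw [bernoulliFourierCoeff, fourierCoeffOn_eq_integral] at h
  have h2 : ∫ t in (0 : ℝ)..1, exp (2 * Real.pi * I * (-n : ℤ) * t) * ((t - 1 / 2 : ℝ) : ℂ) =
      -1 / (2 * Real.pi * I * n) := by
    refine Eq.trans ?_ (h.trans (by simp))
    rw [show (1 : ℝ) / (1 - 0) = 1 by norm_num, one_smul]
    refine intervalIntegral.integral_congr fun t _ => ?_
    rw [fourier_coe_apply, smul_eq_mul]
    simp [bernoulliFun]
  rw [h2]
  have hc : 2 * Real.pi * I ≠ 0 := by simp [Real.pi_ne_zero]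
  rcases eq_or_ne n 0 with rfl | hn
  · simp
  · have : (n : ℂ) ≠ 0 := by exact_mod_cast hn
    field_simp

variable {ι : Type*} [Fintype ι]

/-- A trigonometric polynomial with integer frequencies `e i`. -/
noncomputable def trigPoly (e : ι → ℤ) (x : ι → ℂ) (t : ℝ) : ℂ :=
  ∑ i, x i * exp (2 * Real.pi * I * e i * t)

theorem continuous_trigPoly (e : ι → ℤ) (x : ι → ℂ) : Continuous (trigPoly e x) := by
  unfold trigPoly
  fun_prop

theorem conj_trigPoly_mul (e : ι → ℤ) (x y : ι → ℂ) (t : ℝ) :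
    (starRingEnd ℂ) (trigPoly e x t) * trigPoly e y t =
      ∑ i, ∑ j, (starRingEnd ℂ) (x i) * y j * exp (2 * Real.pi * I * (e j - e i : ℤ) * t) := by
  rw [trigPoly, trigPoly, map_sum, Finset.sum_mul_sum]
  refine Finset.sum_congr rfl fun i _ => Finset.sum_congr rfl fun j _ => ?_
  rw [map_mul, ← exp_conj, mul_mul_mul_comm, ← exp_add]
  congr 2
  simp only [map_mul, map_ofNat, conj_ofReal, conj_I, map_intCast]
  push_cast
  ring

theorem integral_norm_trigPoly_sq {e : ι → ℤ} (he : Function.Injective e) (x : ι → ℂ) :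
    ∫ t in (0 : ℝ)..1, ‖trigPoly e x t‖ ^ 2 = ∑ i, ‖x i‖ ^ 2 := by
  classical
  have h : ∫ t in (0 : ℝ)..1, (starRingEnd ℂ) (trigPoly e x t) * trigPoly e x t =
      ((∑ i, ‖x i‖ ^ 2 : ℝ) : ℂ) := by
    simp only [conj_trigPoly_mul]
    rw [intervalIntegral.integral_finsetSum fun i _ => by
      exact Continuous.intervalIntegrable (by fun_prop) _ _, Complex.ofReal_sum]
    refine Finset.sum_congr rfl fun i _ => ?_
    rw [intervalIntegral.integral_finsetSum fun j _ => by
      exact Continuous.intervalIntegrable (by fun_prop) _ _]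
    simp only [intervalIntegral.integral_const_mul, integral_exp_two_pi_int, sub_eq_zero]
    rw [Finset.sum_eq_single i]
    · simp [Complex.conj_mul']
    · intro j _ hj
      rw [if_neg (he.ne hj), mul_zero]
    · simp
  have h2 : ∫ t in (0 : ℝ)..1, (starRingEnd ℂ) (trigPoly e x t) * trigPoly e x t =
      ((∫ t in (0 : ℝ)..1, ‖trigPoly e x t‖ ^ 2 : ℝ) : ℂ) := by
    rw [← intervalIntegral.integral_ofReal]
    simp [Complex.conj_mul']
  rw [h2] at h
  exact_mod_cast h

/-- Hilbert's inequality. -/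
theorem norm_sum_conj_mul_inv_sub_le {e : ι → ℤ} (he : Function.Injective e) (x y : ι → ℂ) :
    ‖∑ i, ∑ j, (starRingEnd ℂ) (x i) * y j * ((e i - e j : ℤ) : ℂ)⁻¹‖ ≤
      Real.pi / 2 * (∑ i, ‖x i‖ ^ 2 + ∑ i, ‖y i‖ ^ 2) := by
  have h1 : ∑ i, ∑ j, (starRingEnd ℂ) (x i) * y j * ((e i - e j : ℤ) : ℂ)⁻¹ =
      -(2 * Real.pi * I) * ∫ t in (0 : ℝ)..1,
        (starRingEnd ℂ) (trigPoly e x t) * trigPoly e y t * ((t - 1 / 2 : ℝ) : ℂ) := by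
    simp only [conj_trigPoly_mul, Finset.sum_mul]
    rw [intervalIntegral.integral_finsetSum fun i _ => by
      exact Continuous.intervalIntegrable (by fun_prop) _ _, Finset.mul_sum]
    refine Finset.sum_congr rfl fun i _ => ?_
    rw [intervalIntegral.integral_finsetSum fun j _ => by
      exact Continuous.intervalIntegrable (by fun_prop) _ _, Finset.mul_sum]
    refine Finset.sum_congr rfl fun j _ => ?_
    simp only [mul_assoc ((starRingEnd ℂ) (x i) * y j)]
    rw [inv_int_eq_integral, intervalIntegral.integral_const_mul, neg_sub]
    ring
  have hcx := continuous_trigPoly e x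
  have hcy := continuous_trigPoly e y
  -- The sawtooth is at most `1 / 2` in absolute value, and the arithmetic-geometric mean inequality
  -- gives the factor `1 / 4`.
  have h2 : ‖∫ t in (0 : ℝ)..1,
      (starRingEnd ℂ) (trigPoly e x t) * trigPoly e y t * ((t - 1 / 2 : ℝ) : ℂ)‖ ≤
      ∫ t in (0 : ℝ)..1, (‖trigPoly e x t‖ ^ 2 + ‖trigPoly e y t‖ ^ 2) / 4 := by
    refine intervalIntegral.norm_integral_le_of_norm_le zero_le_one (ae_of_all _ fun t ht => ?_)
      (Continuous.intervalIntegrable (by fun_prop) _ _)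
    rw [norm_mul, norm_mul, RCLike.norm_conj, Complex.norm_real, Real.norm_eq_abs]
    have h3 : |t - 1 / 2| ≤ 1 / 2 := by
      rw [abs_le]
      constructor <;> linarith [ht.1, ht.2]
    calc _ ≤ ‖trigPoly e x t‖ * ‖trigPoly e y t‖ * (1 / 2) := by gcongr
      _ ≤ _ := by nlinarith [sq_nonneg (‖trigPoly e x t‖ - ‖trigPoly e y t‖)]
  rw [h1, norm_mul, norm_neg]
  have h3 : ‖(2 * Real.pi * I : ℂ)‖ = 2 * Real.pi := by
    simp [abs_of_pos Real.pi_pos]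
  rw [h3]
  rw [intervalIntegral.integral_div, intervalIntegral.integral_add
    (Continuous.intervalIntegrable (by fun_prop) _ _)
    (Continuous.intervalIntegrable (by fun_prop) _ _), integral_norm_trigPoly_sq he,
    integral_norm_trigPoly_sq he] at h2
  calc _ ≤ 2 * Real.pi * ((∑ i, ‖x i‖ ^ 2 + ∑ i, ‖y i‖ ^ 2) / 4) := by gcongr
    _ = _ := by ring

end Hilbert

theorem ContinuousLinearMap.norm_le_of_norm_inner_le_half {H : Type*} [NormedAddCommGroup H]
    [InnerProductSpace ℂ H] {T : H →L[ℂ] H} {c : ℝ} (hc : 0 ≤ c)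
    (h : ∀ x y, ‖inner ℂ x (T y)‖ ≤ c / 2 * (‖x‖ ^ 2 + ‖y‖ ^ 2)) : ‖T‖ ≤ c := by
  refine norm_le_of_norm_inner_le hc fun x y => ?_
  rcases eq_or_ne x 0 with rfl | hx
  · simp
  rcases eq_or_ne y 0 with rfl | hy
  · simp
  have hx' : 0 < ‖x‖ := norm_pos_iff.2 hx
  have hy' : 0 < ‖y‖ := norm_pos_iff.2 hy
  have h1 := h ((‖y‖ : ℂ) • x) ((‖x‖ : ℂ) • y)
  rw [map_smul, inner_smul_left, inner_smul_right, norm_smul, norm_smul, norm_mul, norm_mul] at h1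
  simp only [Complex.conj_ofReal, Complex.norm_real, norm_norm] at h1
  have h2 : 0 < ‖x‖ * ‖y‖ := by positivity
  refine le_of_mul_le_mul_left ?_ h2
  nlinarith [h1]

/-! ### Matrices as operators on Euclidean space. -/

section Matrix

variable {n : Type*} [Fintype n] [DecidableEq n]

theorem inner_toEuclideanCLM (M : Matrix n n ℂ) (x y : EuclideanSpace ℂ n) :
    inner ℂ x (Matrix.toEuclideanCLM (𝕜 := ℂ) M y) =
      ∑ i, ∑ j, (starRingEnd ℂ) (x i) * y j * M i j := by
  rw [PiLp.inner_apply]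
  refine Finset.sum_congr rfl fun i _ => ?_
  rw [Matrix.ofLp_toEuclideanCLM, RCLike.inner_apply, Matrix.mulVec, dotProduct, Finset.sum_mul]
  refine Finset.sum_congr rfl fun j _ => ?_
  ring

theorem norm_toEuclideanCLM_le_of_norm_le {M : Matrix n n ℂ} {c : ℝ} (hc : 0 ≤ c)
    (hM : ∀ i j, ‖M i j‖ ≤ c) : ‖Matrix.toEuclideanCLM (𝕜 := ℂ) M‖ ≤ c * Fintype.card n := by
  refine ContinuousLinearMap.norm_le_of_norm_inner_le_half (by positivity) fun x y => ?_
  rw [inner_toEuclideanCLM]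
  calc _ ≤ ∑ i, ∑ j, c / 2 * (‖x i‖ ^ 2 + ‖y j‖ ^ 2) := by
        refine norm_sum_le_of_le _ fun i _ => norm_sum_le_of_le _ fun j _ => ?_
        rw [norm_mul, norm_mul, RCLike.norm_conj]
        calc _ ≤ ‖x i‖ * ‖y j‖ * c := by gcongr; exact hM i j
          _ ≤ _ := by nlinarith [mul_nonneg hc (sq_nonneg (‖x i‖ - ‖y j‖))]
    _ = _ := by
        simp only [← Finset.mul_sum, Finset.sum_add_distrib, Finset.sum_const, Finset.card_univ,
          nsmul_eq_mul, EuclideanSpace.norm_sq_eq]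
        ring

theorem diag_basisFun (a : n → ℝ) : (EuclideanSpace.basisFun n ℂ).diag a =
    Matrix.toEuclideanCLM (𝕜 := ℂ) (Matrix.diagonal fun i => (a i : ℂ)) := by
  refine ContinuousLinearMap.ext fun x => (EuclideanSpace.basisFun n ℂ).ext_inner_left fun i => ?_
  rw [OrthonormalBasis.inner_diag_right, EuclideanSpace.basisFun_inner,
    EuclideanSpace.basisFun_inner, Matrix.ofLp_toEuclideanCLM, Matrix.mulVec_diagonal]

end Matrix

/-! ### Matrices that realise the lower bound. -/

section LowerBound

/-- A smoothed triangular part of the Hilbert matrix, tested against the constant vector. -/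
theorem sum_weighted_hilbert_ge (m : ℕ) :
    m * Real.log (m + 1) / 6 ≤ ∑ j : Fin (2 * m), ∑ k : Fin (2 * m),
      ((2 : ℝ)⁻¹ ^ (k : ℕ) / (2⁻¹ ^ (j : ℕ) + 2⁻¹ ^ (k : ℕ))) * (((j : ℤ) - k : ℤ) : ℝ)⁻¹ := by
  set f : ℕ → ℕ → ℝ := fun j k =>
    ((2 : ℝ)⁻¹ ^ k / (2⁻¹ ^ j + 2⁻¹ ^ k)) * (((j : ℤ) - k : ℤ) : ℝ)⁻¹ with hf
  have hS : ∑ j : Fin (2 * m), ∑ k : Fin (2 * m), f j k =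
      ∑ j ∈ Finset.range (2 * m), ∑ k ∈ Finset.range (2 * m), f j k := by
    rw [Finset.sum_range]
    refine Finset.sum_congr rfl fun j _ => ?_
    rw [Finset.sum_range]
  change _ ≤ ∑ j : Fin (2 * m), ∑ k : Fin (2 * m), f j k
  rw [hS]
  have hsymm : ∀ j k, f j k + f k j = f k j + f j k := fun j k => add_comm _ _
  -- The Hilbert kernel is odd, so symmetrizing replaces the weight by `(2⁻¹ ^ k - 2⁻¹ ^ j) / (2⁻¹ ^
  -- k + 2⁻¹ ^ j)`. For `k < j` this is at least `1 / 3`, because `2⁻¹ ^ j ≤ 2⁻¹ ^ k / 2`.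
  have hlow : ∀ j k, k < j → 1 / 3 * (((j - k : ℕ) : ℝ)⁻¹) ≤ f j k + f k j := by
    intro j k hjk
    have e1 : (((j : ℤ) - k : ℤ) : ℝ) = ((j - k : ℕ) : ℝ) := by
      rw [Nat.cast_sub hjk.le]; push_cast; rfl
    have e2 : (((k : ℤ) - j : ℤ) : ℝ) = -((j - k : ℕ) : ℝ) := by
      rw [Nat.cast_sub hjk.le]; push_cast; ring
    have h1 : (2 : ℝ)⁻¹ ^ j ≤ 2⁻¹ * 2⁻¹ ^ k := by
      rw [← pow_succ']
      exact pow_le_pow_of_le_one (by norm_num) (by norm_num) hjk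
    have h2 : (0 : ℝ) < 2⁻¹ ^ j := by positivity
    have h3 : (0 : ℝ) < 2⁻¹ ^ k := by positivity
    simp only [hf]
    rw [e1, e2, inv_neg, mul_neg, ← sub_eq_add_neg, ← sub_mul]
    gcongr
    rw [add_comm ((2 : ℝ)⁻¹ ^ k) (2⁻¹ ^ j), ← sub_div, div_le_div_iff₀ (by norm_num) (by positivity)]
    linarith
  have hnonneg : ∀ j k, 0 ≤ f j k + f k j := by
    intro j k
    rcases lt_trichotomy j k with h | rfl | h
    · rw [hsymm]
      exact le_trans (by positivity) (hlow k j h)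
    · simp [hf]
    · exact le_trans (by positivity) (hlow j k h)
  have htwo : 2 * ∑ j ∈ Finset.range (2 * m), ∑ k ∈ Finset.range (2 * m), f j k =
      ∑ j ∈ Finset.range (2 * m), ∑ k ∈ Finset.range (2 * m), (f j k + f k j) := by
    simp only [Finset.sum_add_distrib]
    rw [two_mul]
    congr 1
    exact Finset.sum_comm
  -- Each of the last `m` rows contains a full harmonic sum of length at least `m`.
  have hharm : ∀ j, m ≤ j → Real.log (m + 1) ≤ ∑ k ∈ Finset.range j, (((j - k : ℕ) : ℝ)⁻¹) := by
    intro j hj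
    have h1 : ∑ k ∈ Finset.range j, (((j - k : ℕ) : ℝ)⁻¹) = (harmonic j : ℝ) := by
      rw [harmonic, ← Finset.sum_range_reflect]
      push_cast
      refine Finset.sum_congr rfl fun k hk => ?_
      rw [Finset.mem_range] at hk
      rw [show j - (j - 1 - k) = k + 1 by omega]
      push_cast
      rfl
    rw [h1]
    refine le_trans ?_ (log_add_one_le_harmonic j)
    push_cast
    gcongr
  have hmain : m * (1 / 3 * Real.log (m + 1)) ≤
      ∑ j ∈ Finset.range (2 * m), ∑ k ∈ Finset.range (2 * m), (f j k + f k j) := by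
    calc m * (1 / 3 * Real.log (m + 1))
        = ∑ j ∈ Finset.Ico m (2 * m), 1 / 3 * Real.log (m + 1) := by
          rw [Finset.sum_const, Nat.card_Ico, nsmul_eq_mul, show 2 * m - m = m by omega]
      _ ≤ ∑ j ∈ Finset.Ico m (2 * m), ∑ k ∈ Finset.range (2 * m), (f j k + f k j) := by
          refine Finset.sum_le_sum fun j hj => ?_
          rw [Finset.mem_Ico] at hj
          calc _ ≤ 1 / 3 * ∑ k ∈ Finset.range j, (((j - k : ℕ) : ℝ)⁻¹) := by
                gcongr
                exact hharm j hj.1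
            _ ≤ ∑ k ∈ Finset.range j, (f j k + f k j) := by
                rw [Finset.mul_sum]
                exact Finset.sum_le_sum fun k hk => hlow j k (Finset.mem_range.1 hk)
            _ ≤ _ := Finset.sum_le_sum_of_subset_of_nonneg
                (Finset.range_subset_range.2 hj.2.le) fun k _ _ => hnonneg j k
      _ ≤ _ := Finset.sum_le_sum_of_subset_of_nonneg
          (fun j hj => Finset.mem_range.2 (Finset.mem_Ico.1 hj).2)
          fun j _ _ => Finset.sum_nonneg fun k _ => hnonneg j k
  linarith

variable {ι : Type u}

/-- The eigenvalues `1 + 2⁻¹ ^ j` and `1 - 2⁻¹ ^ j` on both sides of the kink of `kappa`. -/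
noncomputable def kinkEigenvalue (e : ι → ℕ) : ι ⊕ ι → ℝ
  | .inl j => 1 + 2⁻¹ ^ e j
  | .inr j => 1 - 2⁻¹ ^ e j

theorem kappaFun_kinkEigenvalue_inl (e : ι → ℕ) (j : ι) :
    kappa (kinkEigenvalue e (.inl j)) = 1 := by
  change kappaFun (1 + 2⁻¹ ^ e j) = 1
  have : (0 : ℝ) < 2⁻¹ ^ e j := by positivity
  rw [kappaFun_eq, min_eq_right (by linarith), max_eq_right (by norm_num)]

theorem kappaFun_kinkEigenvalue_inr (e : ι → ℕ) (j : ι) :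
    kappa (kinkEigenvalue e (.inr j)) = 1 - 2⁻¹ ^ e j := by
  change kappaFun (1 - 2⁻¹ ^ e j) = 1 - 2⁻¹ ^ e j
  have h1 : (0 : ℝ) < 2⁻¹ ^ e j := by positivity
  have h2 : (2 : ℝ)⁻¹ ^ e j ≤ 1 := pow_le_one₀ (by norm_num) (by norm_num)
  rw [kappaFun_eq, min_eq_left (by linarith), max_eq_right (by linarith)]

/-- The off-diagonal block of the generator of the rotation. -/
noncomputable def kinkBlock (e : ι → ℕ) (s : ℝ) (j k : ι) : ℝ :=
  s * (((e j : ℤ) - e k : ℤ) : ℝ)⁻¹ / (2⁻¹ ^ e j + 2⁻¹ ^ e k)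

/-- The generator of the rotation, a Hermitian matrix. -/
noncomputable def kinkMatrix (e : ι → ℕ) (s : ℝ) : Matrix (ι ⊕ ι) (ι ⊕ ι) ℂ
  | .inl j, .inr k => (kinkBlock e s j k : ℂ)
  | .inr k, .inl j => (kinkBlock e s j k : ℂ)
  | _, _ => 0

theorem isHermitian_kinkMatrix (e : ι → ℕ) (s : ℝ) : (kinkMatrix e s).IsHermitian := by
  refine Matrix.IsHermitian.ext fun i j => ?_
  rcases i with i | i <;> rcases j with j | j <;> simp [kinkMatrix]

theorem norm_kinkMatrix_le {e : ι → ℕ} {n : ℕ} (he : ∀ i, e i < n) {s : ℝ} (hs : 0 ≤ s)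
    (i j : ι ⊕ ι) : ‖kinkMatrix e s i j‖ ≤ s * 2 ^ n := by
  have key : ∀ j k, |kinkBlock e s j k| ≤ s * 2 ^ n := by
    intro j k
    have h1 : |((((e j : ℤ) - e k : ℤ) : ℝ)⁻¹)| ≤ 1 := by
      rw [abs_inv]
      rcases eq_or_ne ((e j : ℤ) - e k) 0 with h | h
      · simp [h]
      · refine inv_le_one_of_one_le₀ ?_
        rw [← Int.cast_abs]
        exact_mod_cast Int.one_le_abs h
    have h2 : (2 : ℝ)⁻¹ ^ n ≤ 2⁻¹ ^ e j + 2⁻¹ ^ e k := by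
      have h3 : (2 : ℝ)⁻¹ ^ n ≤ 2⁻¹ ^ e j :=
        pow_le_pow_of_le_one (by norm_num) (by norm_num) (he j).le
      have h4 : (0 : ℝ) < 2⁻¹ ^ e k := by positivity
      linarith
    rw [kinkBlock, abs_div, abs_mul, abs_of_nonneg hs,
      abs_of_pos (show (0 : ℝ) < 2⁻¹ ^ e j + 2⁻¹ ^ e k by positivity)]
    calc _ ≤ s * 1 / 2⁻¹ ^ n := by gcongr
      _ = s * 2 ^ n := by rw [mul_one, inv_pow, div_inv_eq_mul]
  have h0 : 0 ≤ s * 2 ^ n := by positivity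
  rcases i with i | i <;> rcases j with j | j <;>
    simp only [kinkMatrix, norm_zero, Complex.norm_real, Real.norm_eq_abs, key, h0]

variable [Fintype ι] [DecidableEq ι]

theorem toEuclideanCLM_commutator_apply (M : Matrix (ι ⊕ ι) (ι ⊕ ι) ℂ) (a : ι ⊕ ι → ℝ)
    (x y : EuclideanSpace ℂ (ι ⊕ ι)) :
    inner ℂ x ((Matrix.toEuclideanCLM (𝕜 := ℂ) M * (EuclideanSpace.basisFun _ ℂ).diag a -
      (EuclideanSpace.basisFun _ ℂ).diag a * Matrix.toEuclideanCLM (𝕜 := ℂ) M) y) =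
    ∑ i, ∑ j, (starRingEnd ℂ) (x i) * y j * (M i j * (a j - a i)) := by
  rw [diag_basisFun, ← map_mul, ← map_mul, ← map_sub, inner_toEuclideanCLM]
  refine Finset.sum_congr rfl fun i _ => Finset.sum_congr rfl fun j _ => ?_
  rw [Matrix.sub_apply, Matrix.mul_diagonal, Matrix.diagonal_mul]
  ring

/-- The commutator of the generator with the diagonal operator is a Hilbert matrix. -/
theorem norm_commutator_kinkMatrix_le {e : ι → ℕ} (he : Function.Injective e) {s : ℝ}
    (hs : 0 ≤ s) :
    ‖Matrix.toEuclideanCLM (𝕜 := ℂ) (kinkMatrix e s) *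
      (EuclideanSpace.basisFun _ ℂ).diag (kinkEigenvalue e) -
      (EuclideanSpace.basisFun _ ℂ).diag (kinkEigenvalue e) *
      Matrix.toEuclideanCLM (𝕜 := ℂ) (kinkMatrix e s)‖ ≤ Real.pi * s := by
  refine ContinuousLinearMap.norm_le_of_norm_inner_le_half (by positivity) fun x y => ?_
  have he' : Function.Injective fun i => (e i : ℤ) := Nat.cast_injective.comp he
  -- The eigenvalue gap across the kink is exactly the denominator of `kinkBlock`.
  have hb : ∀ j k, (kinkBlock e s j k : ℂ) * ((2⁻¹ ^ e j + 2⁻¹ ^ e k : ℝ) : ℂ) =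
      s * (((e j : ℤ) - e k : ℤ) : ℂ)⁻¹ := by
    intro j k
    rw [← Complex.ofReal_mul, kinkBlock, div_mul_cancel₀ _ (by positivity)]
    push_cast
    rfl
  have h1 := norm_sum_conj_mul_inv_sub_le he' (fun i => x (.inl i)) fun i => y (.inr i)
  have h2 := norm_sum_conj_mul_inv_sub_le he' (fun i => x (.inr i)) fun i => y (.inl i)
  rw [toEuclideanCLM_commutator_apply, Fintype.sum_sum_type]
  simp only [Fintype.sum_sum_type]
  have e1 : ∀ j k : ι, (starRingEnd ℂ) (x (.inl j)) * y (.inr k) * (kinkMatrix e s (.inl j) (.inr k) *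
      (kinkEigenvalue e (.inr k) - kinkEigenvalue e (.inl j))) =
      -s * ((starRingEnd ℂ) (x (.inl j)) * y (.inr k) * (((e j : ℤ) - e k : ℤ) : ℂ)⁻¹) := by
    intro j k
    have := hb j k
    simp only [kinkMatrix, kinkEigenvalue]
    push_cast at this ⊢
    linear_combination (-(starRingEnd ℂ) (x (.inl j)) * y (.inr k)) * this
  have e2 : ∀ j k : ι, (starRingEnd ℂ) (x (.inr j)) * y (.inl k) * (kinkMatrix e s (.inr j) (.inl k) *
      (kinkEigenvalue e (.inl k) - kinkEigenvalue e (.inr j))) =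
      -s * ((starRingEnd ℂ) (x (.inr j)) * y (.inl k) * (((e j : ℤ) - e k : ℤ) : ℂ)⁻¹) := by
    intro j k
    have h3 := hb k j
    rw [show ((e k : ℤ) - e j : ℤ) = -((e j : ℤ) - e k) by ring, Int.cast_neg, inv_neg] at h3
    simp only [kinkMatrix, kinkEigenvalue]
    push_cast at h3 ⊢
    linear_combination ((starRingEnd ℂ) (x (.inr j)) * y (.inl k)) * h3
  have e3 : ∀ j k : ι, kinkMatrix e s (.inl j) (.inl k) = 0 := fun _ _ => rfl
  have e4 : ∀ j k : ι, kinkMatrix e s (.inr j) (.inr k) = 0 := fun _ _ => rfl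
  simp only [e1, e2, e3, e4, zero_mul, mul_zero, Finset.sum_const_zero, zero_add, add_zero,
    ← Finset.mul_sum]
  rw [← mul_add, norm_mul, norm_neg, Complex.norm_real, Real.norm_eq_abs, abs_of_nonneg hs,
    EuclideanSpace.norm_sq_eq, EuclideanSpace.norm_sq_eq, Fintype.sum_sum_type,
    Fintype.sum_sum_type]
  calc _ ≤ s * (Real.pi / 2 * (∑ i, ‖x (.inl i)‖ ^ 2 + ∑ i, ‖y (.inr i)‖ ^ 2) +
      Real.pi / 2 * (∑ i, ‖x (.inr i)‖ ^ 2 + ∑ i, ‖y (.inl i)‖ ^ 2)) := by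
        gcongr
        exact norm_add_le_of_le h1 h2
    _ = _ := by ring

/-- As `κ` is constant above the kink, the gap `2⁻¹ ^ j + 2⁻¹ ^ k` shrinks to `2⁻¹ ^ k`, leaving the
weighted Hilbert matrix. The test vectors are the constants on the two halves, each of squared norm
`2 * m`. -/
theorem le_norm_commutator_kappa_kinkMatrix {m : ℕ} (hm : m ≠ 0) (e : ι ≃ Fin (2 * m)) {s : ℝ}
    (hs : 0 ≤ s) :
    s * Real.log (m + 1) / 12 ≤ ‖Matrix.toEuclideanCLM (𝕜 := ℂ) (kinkMatrix (fun i => e i) s) *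
      (EuclideanSpace.basisFun _ ℂ).diag (fun i => kappa (kinkEigenvalue (fun i => e i) i)) -
      (EuclideanSpace.basisFun _ ℂ).diag (fun i => kappa (kinkEigenvalue (fun i => e i) i)) *
      Matrix.toEuclideanCLM (𝕜 := ℂ) (kinkMatrix (fun i => e i) s)‖ := by
  set C := Matrix.toEuclideanCLM (𝕜 := ℂ) (kinkMatrix (fun i => e i) s) *
      (EuclideanSpace.basisFun _ ℂ).diag (fun i => kappa (kinkEigenvalue (fun i => e i) i)) -
      (EuclideanSpace.basisFun _ ℂ).diag (fun i => kappa (kinkEigenvalue (fun i => e i) i)) *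
      Matrix.toEuclideanCLM (𝕜 := ℂ) (kinkMatrix (fun i => e i) s) with hC
  set x : EuclideanSpace ℂ (ι ⊕ ι) := WithLp.toLp 2 (Sum.elim (fun _ => 1) fun _ => 0) with hx
  set y : EuclideanSpace ℂ (ι ⊕ ι) := WithLp.toLp 2 (Sum.elim (fun _ => 0) fun _ => 1) with hy
  have hcard : Fintype.card ι = 2 * m := by rw [Fintype.card_congr e, Fintype.card_fin]
  have hxn : ‖x‖ ^ 2 = 2 * m := by
    rw [EuclideanSpace.norm_sq_eq, Fintype.sum_sum_type]
    simp [hx, hcard]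
  have hyn : ‖y‖ ^ 2 = 2 * m := by
    rw [EuclideanSpace.norm_sq_eq, Fintype.sum_sum_type]
    simp [hy, hcard]
  have hin : inner ℂ x (C y) = ((-(s * ∑ j : Fin (2 * m), ∑ k : Fin (2 * m),
      ((2 : ℝ)⁻¹ ^ (k : ℕ) / (2⁻¹ ^ (j : ℕ) + 2⁻¹ ^ (k : ℕ))) *
        (((j : ℤ) - k : ℤ) : ℝ)⁻¹) : ℝ) : ℂ) := by
    rw [hC, toEuclideanCLM_commutator_apply, Fintype.sum_sum_type]
    simp only [Fintype.sum_sum_type, kappaFun_kinkEigenvalue_inl, kappaFun_kinkEigenvalue_inr]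
    simp only [hx, hy, Sum.elim_inl, Sum.elim_inr, map_zero, map_one, zero_mul, mul_zero, one_mul,
      Finset.sum_const_zero, zero_add, add_zero, kinkMatrix]
    rw [← e.sum_comp, Finset.mul_sum, ← Finset.sum_neg_distrib, Complex.ofReal_sum]
    refine Finset.sum_congr rfl fun j _ => ?_
    rw [← e.sum_comp, Finset.mul_sum, ← Finset.sum_neg_distrib, Complex.ofReal_sum]
    refine Finset.sum_congr rfl fun k _ => ?_
    rw [← Complex.ofReal_sub, ← Complex.ofReal_mul, kinkBlock]
    congr 1
    ring
  have h1 : ‖inner ℂ x (C y)‖ ≤ ‖x‖ * (‖C‖ * ‖y‖) :=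
    (norm_inner_le_norm _ _).trans (by gcongr; exact C.le_opNorm y)
  have h2 : ‖x‖ = ‖y‖ := by
    rw [← sq_eq_sq₀ (norm_nonneg _) (norm_nonneg _), hxn, hyn]
  have h3 := sum_weighted_hilbert_ge m
  rw [hin, Complex.norm_real, norm_neg, Real.norm_eq_abs] at h1
  have h4 := mul_le_mul_of_nonneg_left h3 hs
  have h5 := h4.trans ((le_abs_self _).trans h1)
  have h6 : ‖x‖ * (‖C‖ * ‖y‖) = 2 * m * ‖C‖ := by
    rw [← hyn, h2]; ring
  rw [h6] at h5
  have hm' : (0 : ℝ) < m := by positivity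
  refine le_of_mul_le_mul_left ?_ hm'
  linarith

end LowerBound

theorem ofReal_log_le_operatorModulus_kappa {m : ℕ} (hm : m ≠ 0) {δ : ℝ} (hδ : 0 < δ)
    (h : δ * 16 ^ m ≤ 1) :
    ENNReal.ofReal (δ * Real.log (m + 1) / (48 * Real.pi)) ≤ operatorModulus.{u} kappa δ := by
  set e : ULift.{u} (Fin (2 * m)) ≃ Fin (2 * m) := Equiv.ulift
  -- The commutator bound `π * s`, doubled by the Cayley transform, equals `δ`.
  set s : ℝ := δ / (2 * Real.pi) with hs
  have hpi := Real.pi_pos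
  have hs0 : 0 < s := by positivity
  set R := Matrix.toEuclideanCLM (𝕜 := ℂ) (kinkMatrix (fun i => (e i : ℕ)) s) with hR
  have hRsa : IsSelfAdjoint R := by
    rw [IsSelfAdjoint, hR, ← map_star, Matrix.star_eq_conjTranspose,
      (isHermitian_kinkMatrix _ s).eq]
  -- The entries are at most `s * 4 ^ m` and the dimension is `4 * m`. With `m < 4 ^ m` this crude
  -- bound is absorbed by `δ * 16 ^ m ≤ 1`; only the logarithm of `1 / δ` matters, so nothing is
  -- lost.
  have hR1 : ‖R‖ ≤ 1 := by
    refine (norm_toEuclideanCLM_le_of_norm_le (by positivity)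
      (norm_kinkMatrix_le (fun i => (e i).2) hs0.le)).trans ?_
    have h1 : (m : ℝ) < 4 ^ m := by exact_mod_cast Nat.lt_pow_self (by norm_num)
    have h2 : (4 : ℝ) ^ m * 4 ^ m = 16 ^ m := by rw [← mul_pow]; norm_num
    have h3 : (2 : ℝ) ^ (2 * m) = 4 ^ m := by rw [pow_mul]; norm_num
    rw [Fintype.card_sum, Fintype.card_congr e, Fintype.card_fin, h3]
    push_cast
    have h4 : s * 4 ≤ δ := by
      rw [hs, div_mul_eq_mul_div, div_le_iff₀ (by positivity)]
      nlinarith [Real.pi_gt_three]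
    calc s * 4 ^ m * (2 * m + 2 * m) = (s * 4) * (4 ^ m * m) := by ring
      _ ≤ δ * (4 ^ m * 4 ^ m) := by gcongr
      _ ≤ 1 := by rwa [h2]
  obtain ⟨U, hU⟩ := exists_unitary_commutator hRsa hR1
  set b := EuclideanSpace.basisFun (ULift.{u} (Fin (2 * m)) ⊕ ULift.{u} (Fin (2 * m))) ℂ with hb
  set a := kinkEigenvalue fun i => (e i : ℕ) with ha
  have hinj : Function.Injective fun i => (e i : ℕ) := Fin.val_injective.comp e.injective
  have h1 := (hU (b.diag a) ((b.map U).diag a) (b.diag_map a U)).1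
  have h2 := (hU (b.diag fun i => kappa (a i)) _ (b.diag_map (fun i => kappa (a i)) U)).2
  have h3 := norm_commutator_kinkMatrix_le hinj hs0.le
  have h4 := le_norm_commutator_kappa_kinkMatrix hm e hs0.le
  have h5 : ‖b.diag a - (b.map U).diag a‖ ≤ δ := by
    refine h1.trans ((mul_le_mul_of_nonneg_left h3 zero_le_two).trans (le_of_eq ?_))
    rw [hs]
    field_simp
  refine le_trans ?_ (b.enorm_sub_le_operatorModulus a (b.map U) a kappa h5)
  rw [← ofReal_norm]
  refine ENNReal.ofReal_le_ofReal ?_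
  have h6 := h4.trans h2
  have h7 : δ * Real.log (m + 1) / (48 * Real.pi) = s * Real.log (m + 1) / 12 / 2 := by
    rw [hs]
    field_simp
    ring
  rw [h7]
  linarith

/-- Scalar operators. -/
theorem ofReal_min_le_operatorModulus_kappa {δ : ℝ} (hδ : 0 < δ) :
    ENNReal.ofReal (min δ 1) ≤ operatorModulus.{u} kappa δ := by
  set b := EuclideanSpace.basisFun (ULift.{u} (Fin 1)) ℂ
  have hn : ∀ c : ℝ, ‖(c : ℂ) • (1 : EuclideanSpace ℂ (ULift.{u} (Fin 1)) →L[ℂ]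
      EuclideanSpace ℂ (ULift.{u} (Fin 1)))‖ = |c| := by
    intro c
    rw [norm_smul, norm_one, mul_one, Complex.norm_real, Real.norm_eq_abs]
  have h0 : 0 < min δ 1 := lt_min hδ one_pos
  have h1 : ‖(b.diag fun _ => min δ 1) - b.diag fun _ => 0‖ ≤ δ := by
    rw [b.diag_const, b.diag_const, ← sub_smul, ← Complex.ofReal_sub, hn, sub_zero, abs_of_pos h0]
    exact min_le_left _ _
  refine le_trans ?_ (b.enorm_sub_le_operatorModulus _ b _ kappa h1)
  have h2 : kappa (min δ 1) = min δ 1 := by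
    change kappaFun _ = _
    rw [kappaFun_eq, min_eq_left (min_le_right _ _), max_eq_right (by linarith)]
  have h3 : kappa 0 = 0 := by
    change kappaFun _ = _
    simp [kappaFun_eq]
  rw [← ofReal_norm, b.diag_const, b.diag_const, ← sub_smul, ← Complex.ofReal_sub, hn, h2,
    h3, sub_zero, abs_of_pos h0]

/-! ### Elementary logarithmic estimates and the final assembly. -/

theorem log_one_add_log_le_inv {δ : ℝ} (hδ : 0 < δ) :
    Real.log (1 + Real.log (1 + δ⁻¹)) ≤ δ⁻¹ := by
  have h0 : 0 < δ⁻¹ := by positivity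
  have h1 := Real.log_le_sub_one_of_pos (show 0 < 1 + δ⁻¹ by linarith)
  have h2 : 0 ≤ Real.log (1 + δ⁻¹) := Real.log_nonneg (by linarith)
  have h3 := Real.log_le_sub_one_of_pos (show 0 < 1 + Real.log (1 + δ⁻¹) by linarith)
  linarith

theorem inv_two_add_le_log_one_add_log {δ : ℝ} (hδ : 0 < δ) :
    (2 + δ)⁻¹ ≤ Real.log (1 + Real.log (1 + δ⁻¹)) := by
  have h0 : 0 < δ⁻¹ := by positivity
  have h1 := Real.one_sub_inv_le_log_of_pos (show 0 < 1 + δ⁻¹ by linarith)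
  have h2 : 1 - (1 + δ⁻¹)⁻¹ = (1 + δ)⁻¹ := by
    field_simp
    ring
  rw [h2] at h1
  have h3 : 0 < (1 + δ)⁻¹ := by positivity
  have h4 := Real.one_sub_inv_le_log_of_pos (show 0 < 1 + (1 + δ)⁻¹ by linarith)
  have h5 : 1 - (1 + (1 + δ)⁻¹)⁻¹ = (2 + δ)⁻¹ := by
    field_simp
    ring
  rw [h5] at h4
  refine h4.trans (Real.log_le_log (by linarith) (by linarith))

theorem log_one_add_log_le_of_inv_lt {δ : ℝ} (hδ : 0 < δ) {m : ℕ} (hm : m ≠ 0)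
    (h : δ⁻¹ < 16 ^ (m + 1)) :
    Real.log (1 + Real.log (1 + δ⁻¹)) ≤ 4 * Real.log (m + 1) := by
  have h0 : 0 < δ⁻¹ := by positivity
  have hm1 : (1 : ℝ) ≤ m := by exact_mod_cast Nat.one_le_iff_ne_zero.2 hm
  have h1 : Real.log (1 + δ⁻¹) ≤ 3 * (m + 2) := by
    have h2 : 1 + δ⁻¹ ≤ 16 ^ (m + 2) := by
      have h3 : (1 : ℝ) ≤ 16 ^ (m + 1) := one_le_pow₀ (by norm_num)
      rw [pow_succ _ (m + 1)]
      linarith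
    refine (Real.log_le_log (by linarith) h2).trans ?_
    rw [Real.log_pow, show (16 : ℝ) = 2 ^ 4 by norm_num, Real.log_pow]
    push_cast
    have := Real.log_two_lt_d9
    nlinarith
  have h2 : 0 ≤ Real.log (1 + δ⁻¹) := Real.log_nonneg (by linarith)
  rw [show (4 : ℝ) * Real.log (m + 1) = Real.log ((m + 1) ^ 4) by rw [Real.log_pow]; norm_num]
  refine Real.log_le_log (by linarith) ?_
  have h3 : (8 : ℝ) ≤ (m + 1) ^ 3 := by
    calc (8 : ℝ) = 2 ^ 3 := by norm_num
      _ ≤ (m + 1) ^ 3 := by gcongr; linarith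
  rw [pow_succ]
  nlinarith

theorem natLog_two_le (k : ℕ) (hk : k ≠ 0) : (Nat.log 2 k : ℝ) ≤ 2 * Real.log k := by
  have h1 : (2 : ℝ) ^ Nat.log 2 k ≤ k := by exact_mod_cast Nat.pow_log_le_self 2 hk
  have h2 := Real.log_le_log (by positivity) h1
  rw [Real.log_pow] at h2
  have h3 := Real.log_two_gt_d9
  have h4 : (0 : ℝ) ≤ Nat.log 2 k := by positivity
  nlinarith

theorem loglog_le {δ : ℝ} (hδ : 0 < δ) {N : ℕ} (hN : N ≠ 0) (h : N ≤ δ⁻¹) :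
    (loglog (2 * N) : ℝ) ≤ 2 * Real.log (1 + Real.log (1 + δ⁻¹)) + 5 := by
  have h0 : 0 < δ⁻¹ := by positivity
  set L := Real.log (1 + δ⁻¹) with hL
  have hL0 : 0 ≤ L := Real.log_nonneg (by linarith)
  have hN1 : 1 ≤ N := Nat.one_le_iff_ne_zero.2 hN
  have h1 : ((Nat.log 2 (2 * N) : ℕ) : ℝ) ≤ 4 * L := by
    have h2 : Real.log ((2 * N : ℕ) : ℝ) ≤ 2 * L := by
      rw [show 2 * L = Real.log ((1 + δ⁻¹) ^ 2) by rw [Real.log_pow]; norm_num [hL]]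
      refine Real.log_le_log (by positivity) ?_
      push_cast
      nlinarith
    linarith [natLog_two_le (2 * N) (by omega)]
  have h2 : Nat.log 2 (2 * N) ≠ 0 := by
    have := Nat.log_pos one_lt_two (show 2 ≤ 2 * N by omega)
    omega
  have h3 := natLog_two_le _ h2
  have h4 : Real.log ((Nat.log 2 (2 * N) : ℕ) : ℝ) ≤ Real.log (1 + L) + 2 := by
    refine (Real.log_le_log (by positivity) (show _ ≤ (1 + L) * 4 by linarith)).trans ?_
    rw [Real.log_mul (by linarith) (by norm_num), show (4 : ℝ) = 2 ^ 2 by norm_num, Real.log_pow]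
    have := Real.log_two_lt_d9
    push_cast
    linarith
  rw [loglog]
  push_cast
  linarith

theorem operatorModulus_kappa_lower {δ : ℝ} (hδ : 0 < δ) :
    ENNReal.ofReal (1 / (192 * Real.pi) * δ * Real.log (1 + Real.log (1 + δ⁻¹))) ≤
      operatorModulus.{u} kappa δ := by
  have hpi := Real.pi_gt_three
  -- The threshold guarantees `m ≥ 1` for the largest `m` with `16 ^ m ≤ δ⁻¹`.
  rcases le_or_gt δ (1 / 16) with h | h
  · set m := Nat.log 16 ⌊δ⁻¹⌋₊ with hm
    have h16 : 16 ≤ δ⁻¹ := by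
      rw [le_inv_comm₀ (by norm_num) hδ]
      linarith
    have h16' : 16 ≤ ⌊δ⁻¹⌋₊ := Nat.le_floor (by exact_mod_cast h16)
    have hm0 : m ≠ 0 := (Nat.log_pos (by norm_num) h16').ne'
    have h1 : (16 : ℝ) ^ m ≤ δ⁻¹ := by
      refine le_trans ?_ (Nat.floor_le (by positivity))
      exact_mod_cast Nat.pow_log_le_self 16 (by omega)
    have h2 : δ⁻¹ < 16 ^ (m + 1) := by
      refine (Nat.lt_floor_add_one _).trans_le ?_
      exact_mod_cast Nat.lt_pow_succ_log_self (by norm_num) _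
    refine le_trans (ENNReal.ofReal_le_ofReal ?_)
      (ofReal_log_le_operatorModulus_kappa hm0 hδ ?_)
    · have h3 := log_one_add_log_le_of_inv_lt hδ hm0 h2
      calc _ ≤ 1 / (192 * Real.pi) * δ * (4 * Real.log (m + 1)) := by gcongr
        _ = _ := by
          field_simp
          ring
    · calc δ * 16 ^ m ≤ δ * δ⁻¹ := by gcongr
        _ = 1 := mul_inv_cancel₀ hδ.ne'
  · refine le_trans (ENNReal.ofReal_le_ofReal ?_) (ofReal_min_le_operatorModulus_kappa hδ)
    have h1 : 1 / 16 ≤ min δ 1 := le_min h.le (by norm_num)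
    refine le_trans ?_ h1
    have h2 := log_one_add_log_le_inv hδ
    calc _ ≤ 1 / (192 * Real.pi) * δ * δ⁻¹ := by gcongr
      _ = 1 / (192 * Real.pi) := by rw [mul_assoc, mul_inv_cancel₀ hδ.ne', mul_one]
      _ ≤ 1 / 16 := by gcongr; linarith

theorem norm_le_two_of_inner_self {H : Type u} [NormedAddCommGroup H] [InnerProductSpace ℂ H]
    [CompleteSpace H] {E : SpectralMeasure H} {T : H →L[ℂ] H}
    (hT : ∀ x : H, inner ℂ x (T x) = ((∫ t, kappa t ∂(E.scalarMeasure x) : ℝ) : ℂ)) :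
    ‖T‖ ≤ 2 := by
  refine ContinuousLinearMap.norm_le_of_norm_inner_le zero_le_two fun x y => ?_
  have h := norm_inner_le_of_norm_inner_self_le ((T : H →ₗ[ℂ] H) ∘ₗ (⊤ : Submodule ℂ H).subtype)
    (h := 1) (fun x => ?_) ⟨x, trivial⟩ ⟨y, trivial⟩
  · simpa using h
  · change ‖inner ℂ (x : H) (T x)‖ ≤ 1 * ‖(x : H)‖ ^ 2
    rw [hT, Complex.norm_real, ← E.scalarMeasure_real_univ]
    exact norm_integral_le_of_norm_le_const (ae_of_all _ fun t => abs_kappaFun_le_one t)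

theorem operatorModulus_kappa_upper {δ : ℝ} (hδ : 0 < δ) :
    operatorModulus.{u} kappa δ ≤
      ENNReal.ofReal (1200 * δ * Real.log (1 + Real.log (1 + δ⁻¹))) := by
  refine sSup_le ?_
  rintro r ⟨H, _, _, _, A, B, fA, fB, -, -, hAB, ⟨E, hE, hfA⟩, ⟨F, hF, hfB⟩, rfl⟩
  rw [← ofReal_norm]
  refine ENNReal.ofReal_le_ofReal ?_
  set g := Real.log (1 + Real.log (1 + δ⁻¹)) with hg
  rcases le_or_gt δ (1 / 16) with h | h
  · set N := ⌊δ⁻¹⌋₊ with hN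
    have h16 : 16 ≤ δ⁻¹ := by
      rw [le_inv_comm₀ (by norm_num) hδ]
      linarith
    have hN16 : 16 ≤ N := Nat.le_floor (by exact_mod_cast h16)
    have hNle : (N : ℝ) ≤ δ⁻¹ := Nat.floor_le (by positivity)
    have hNlt : δ⁻¹ < N + 1 := Nat.lt_floor_add_one _
    have h1 := SpectralMeasure.norm_sub_le_of_isSpectralMeasureOf hδ.le hAB hE hF hfA hfB
      (N := N) (by omega)
    have h2 := loglog_le hδ (show N ≠ 0 by omega) hNle
    have hN0 : (0 : ℝ) < N := by positivity
    have h3 : 4 / N ≤ 8 * δ := by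
      rw [div_le_iff₀ hN0]
      have h4 : δ * δ⁻¹ = 1 := mul_inv_cancel₀ hδ.ne'
      nlinarith
    have hg0 : 1 / 2 ≤ g := by
      have hL : 1 ≤ Real.log (1 + δ⁻¹) := by
        rw [Real.le_log_iff_exp_le (by linarith)]
        linarith [Real.exp_one_lt_d9]
      have h4 : Real.log 2 ≤ g := Real.log_le_log (by norm_num) (by linarith)
      linarith [Real.log_two_gt_d9]
    calc ‖fA - fB‖ ≤ (4 * loglog (2 * N) + 40) * (4 / N + δ) + 4 / N := h1
      _ ≤ (4 * (2 * g + 5) + 40) * (8 * δ + δ) + 8 * δ := by gcongr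
      -- The middle expression is `(72 * g + 548) * δ`, and `g ≥ 1 / 2` absorbs the constant: `72 +
      -- 1096 ≤ 1200`.
      _ ≤ 1200 * δ * g := by nlinarith
  · have h1 : ‖fA - fB‖ ≤ 4 := by
      have := norm_sub_le_of_le (norm_le_two_of_inner_self hfA) (norm_le_two_of_inner_self hfB)
      linarith
    have h2 := inv_two_add_le_log_one_add_log hδ
    -- The left side is the value of `δ / (2 + δ)` at the threshold `δ = 1 / 16`; then `4 ≤ 1200 /
    -- 33`.
    have h3 : 1 / 33 ≤ δ * (2 + δ)⁻¹ := by
      rw [← div_eq_mul_inv, div_le_div_iff₀ (by norm_num) (by linarith)]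
      linarith
    have h4 : δ * (2 + δ)⁻¹ ≤ δ * g := by gcongr
    linarith

theorem mainTheorem5 :
    ∃ c₁ c₂ : ℝ, 0 < c₁ ∧ 0 < c₂ ∧ ∀ δ : ℝ, 0 < δ →
      ENNReal.ofReal (c₁ * δ * Real.log (1 + Real.log (1 + δ⁻¹))) ≤ operatorModulus.{u} kappa δ ∧
      operatorModulus.{u} kappa δ ≤
        ENNReal.ofReal (c₂ * δ * Real.log (1 + Real.log (1 + δ⁻¹))) := by
  exact ⟨1 / (192 * Real.pi), 1200, by positivity, by norm_num, fun δ hδ =>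
    ⟨operatorModulus_kappa_lower hδ, operatorModulus_kappa_upper hδ⟩⟩
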